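/- **Chevalley restriction theorem.** For a finite-dimensional complex vector space $V$ let $\mathbb C[V]$ be the algebra of polynomial functions on $V$, graded by degree. Let $\mathfrak g$ be a finite-dimensional complex semisimple Lie algebra, $\mathfrak h\subset\mathfrak g$ a Cartan subalgebra, and $W$ the Weyl group of the root system of $(\mathfrak g,\mathfrak h)$, acting on $\mathfrak h$. Let $\mathfrak g$ act on $\mathbb C[\mathfrak g]$ by the derivations $(x\cdot F)(y)=\frac{d}{dt}\big|_{t=0}F(y-t[x,y])$, let $W$ act on $\mathbb C[\mathfrak h]$ by $(w\cdot f)(h)=f(w^{-1}h)$, and let $\mathbb C[\mathfrak g]^{\mathfrak g}=\{F: x\cdot F=0\ \ \forall x\in\mathfrak g\}$ and $\mathbb C[\mathfrak h]^W=\{f: w\cdot f=f\ \ \forall w\in W\}$ be the algebras of invariants. For $F\in\mathbb C[\mathfrak g]^{\mathfrak g}$ let $\mathrm{Res}(F)=F|_{\mathfrak h}$. Then: (i) $\mathrm{Res}(F)\in\mathbb C[\mathfrak h]^W$ for every $F\in\mathbb C[\mathfrak g]^{\mathfrak g}$. (ii) $\mathbb C[\mathfrak g]^{\mathfrak g}$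 and $\mathbb C[\mathfrak h]^W$ are graded subalgebras of $\mathbb C[\mathfrak g]$ and $\mathbb C[\mathfrak h]$, and $\mathrm{Res}:\mathbb C[\mathfrak g]^{\mathfrak g}\to\mathbb C[\mathfrak h]^W$ is an isomorphism of graded algebras: it is an algebra isomorphism which, for every $n\ge 0$, maps the homogeneous invariants of degree $n$ on $\mathfrak g$ onto the homogeneous $W$-invariants of degree $n$ on $\mathfrak h$. -/

import Mathlib

namespace ChevalleyRestriction

noncomputable section

open Module

/-- `ℂ[V]`: the algebra of polynomial functions on a complex vector space `V`, i.e. the algebra of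
functions `V → ℂ` generated by the linear functionals. -/
def PolyFun (V : Type*) [AddCommGroup V] [Module ℂ V] : Subalgebra ℂ (V → ℂ) :=
  Algebra.adjoin ℂ (Set.range fun l : Dual ℂ V => (l : V → ℂ))

section PolyFun

variable {V U : Type*} [AddCommGroup V] [Module ℂ V] [AddCommGroup U] [Module ℂ U]

variable (V) in
/-- The inclusion of the linear functionals `V* → ℂ[V]`. -/
def linearPart : Dual ℂ V →ₗ[ℂ] PolyFun V where
  toFun l := ⟨l, Algebra.subset_adjoin ⟨l, rfl⟩⟩
  map_add' _ _ := rfl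
  map_smul' _ _ := rfl

variable (V) in
/-- The homogeneous polynomial functions of degree `n`: the linear span in `ℂ[V]` of the products
of `n` linear functionals. -/
def homogeneous (n : ℕ) : Submodule ℂ (PolyFun V) :=
  LinearMap.range (linearPart V) ^ n

/-- The degree `n` part `A ∩ ℂ[V]ₙ` of a subalgebra `A` of `ℂ[V]`. -/
def degreePart (A : Subalgebra ℂ (PolyFun V)) (n : ℕ) : Submodule ℂ A :=
  (homogeneous V n).comap A.val.toLinearMap

theorem comp_mem (f : U →ₗ[ℂ] V) {F : V → ℂ} (hF : F ∈ PolyFun V) : F ∘ f ∈ PolyFun U := by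
  induction hF using Algebra.adjoin_induction with
  | mem F hF =>
    obtain ⟨l, rfl⟩ := hF
    exact Algebra.subset_adjoin ⟨l ∘ₗ f, rfl⟩
  | algebraMap r => exact (PolyFun U).algebraMap_mem r
  | add F G _ _ h₁ h₂ => exact add_mem h₁ h₂
  | mul F G _ _ h₁ h₂ => exact mul_mem h₁ h₂

/-- Pullback `F ↦ F ∘ f` of polynomial functions along a linear map `f : U → V`. -/
def pullback (f : U →ₗ[ℂ] V) : PolyFun V →ₐ[ℂ] PolyFun U where
  toFun F := ⟨(F : V → ℂ) ∘ f, comp_mem f F.2⟩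
  map_one' := rfl
  map_mul' _ _ := rfl
  map_zero' := rfl
  map_add' _ _ := rfl
  commutes' _ := rfl

theorem pullback_id : pullback (LinearMap.id : V →ₗ[ℂ] V) = AlgHom.id ℂ (PolyFun V) := rfl

theorem pullback_mul (f g : End ℂ V) : pullback (g * f) = (pullback f).comp (pullback g) := rfl

theorem lineDifferentiableAt {F : V → ℂ} (hF : F ∈ PolyFun V) (y v : V) :
    LineDifferentiableAt ℂ F y v := by
  induction hF using Algebra.adjoin_induction with
  | mem F hF =>
    obtain ⟨l, rfl⟩ := hF
    simp only [LineDifferentiableAt, map_add, map_smul, smul_eq_mul]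
    fun_prop
  | algebraMap r => exact differentiableAt_const r
  | add F G _ _ h₁ h₂ => exact DifferentiableAt.add h₁ h₂
  | mul F G _ _ h₁ h₂ => exact DifferentiableAt.mul h₁ h₂

theorem lineDeriv_linear (l : Dual ℂ V) (y v : V) : lineDeriv ℂ (l : V → ℂ) y v = l v := by
  simp [lineDeriv]

theorem lineDeriv_add {F G : V → ℂ} (hF : F ∈ PolyFun V) (hG : G ∈ PolyFun V) (y v : V) :
    lineDeriv ℂ (F + G) y v = lineDeriv ℂ F y v + lineDeriv ℂ G y v :=
  deriv_add (lineDifferentiableAt hF y v) (lineDifferentiableAt hG y v)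

theorem lineDeriv_mul {F G : V → ℂ} (hF : F ∈ PolyFun V) (hG : G ∈ PolyFun V) (y v : V) :
    lineDeriv ℂ (F * G) y v = F y * lineDeriv ℂ G y v + G y * lineDeriv ℂ F y v := by
  have := deriv_mul (lineDifferentiableAt hF y v) (lineDifferentiableAt hG y v)
  simp only [zero_smul, add_zero] at this
  rw [mul_comm (G y), add_comm]
  exact this

theorem lineDeriv_mem (A : End ℂ V) {F : V → ℂ} (hF : F ∈ PolyFun V) :
    (fun y => lineDeriv ℂ F y (A y)) ∈ PolyFun V := by
  induction hF using Algebra.adjoin_induction with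
  | mem F hF =>
    obtain ⟨l, rfl⟩ := hF
    simp only [lineDeriv_linear]
    exact Algebra.subset_adjoin ⟨l ∘ₗ A, rfl⟩
  | algebraMap r =>
    have : (fun y => lineDeriv ℂ (algebraMap ℂ (V → ℂ) r) y (A y)) = 0 :=
      funext fun _ => deriv_const (0 : ℂ) r
    exact this ▸ (PolyFun V).zero_mem
  | add F G hF hG h₁ h₂ =>
    simp only [lineDeriv_add hF hG]
    exact add_mem h₁ h₂
  | mul F G hF hG h₁ h₂ =>
    simp only [lineDeriv_mul hF hG]
    exact add_mem (mul_mem hF h₂) (mul_mem hG h₁)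

/-- The derivative of polynomial functions along the linear vector field `y ↦ A y`:
`F ↦ (y ↦ d/dt F(y + t A y) at t = 0)`. -/
def vectorField (A : End ℂ V) : Derivation ℂ (PolyFun V) (PolyFun V) :=
  Derivation.mk'
    { toFun := fun F => ⟨fun y => lineDeriv ℂ (F : V → ℂ) y (A y), lineDeriv_mem A F.2⟩
      map_add' := fun F G => Subtype.ext <| funext fun y => lineDeriv_add F.2 G.2 y (A y)
      map_smul' := fun c F => Subtype.ext <| funext fun y =>
        deriv_const_smul c (lineDifferentiableAt F.2 y (A y)) }
    fun F G => Subtype.ext <| funext fun y => lineDeriv_mul F.2 G.2 y (A y)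

theorem vectorField_apply (A : End ℂ V) (F : PolyFun V) (y : V) :
    (vectorField A F : V → ℂ) y = lineDeriv ℂ (F : V → ℂ) y (A y) := rfl

theorem derivation_ext {D₁ D₂ : Derivation ℂ (PolyFun V) (PolyFun V)}
    (h : ∀ l, D₁ (linearPart V l) = D₂ (linearPart V l)) : D₁ = D₂ := by
  ext1 F
  obtain ⟨F, hF⟩ := F
  induction hF using Algebra.adjoin_induction with
  | mem F hF =>
    obtain ⟨l, rfl⟩ := hF
    exact h l
  | algebraMap r =>
    exact (D₁.map_algebraMap r).trans (D₂.map_algebraMap r).symm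
  | add F G hF hG h₁ h₂ =>
    have : (⟨F + G, add_mem hF hG⟩ : PolyFun V) = ⟨F, hF⟩ + ⟨G, hG⟩ := rfl
    exact this ▸ by rw [map_add, map_add, h₁, h₂]
  | mul F G hF hG h₁ h₂ =>
    have : (⟨F * G, mul_mem hF hG⟩ : PolyFun V) = ⟨F, hF⟩ * ⟨G, hG⟩ := rfl
    exact this ▸ by rw [Derivation.leibniz, Derivation.leibniz, h₁, h₂]

theorem vectorField_linear (A : End ℂ V) (l : Dual ℂ V) :
    vectorField A (linearPart V l) = linearPart V (l ∘ₗ A) :=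
  Subtype.ext <| funext fun y => lineDeriv_linear l y (A y)

end PolyFun

section Lie

variable (L : Type*) [LieRing L] [LieAlgebra ℂ L]

/-- The action of a Lie algebra `L` on `ℂ[L]` by derivations induced by the adjoint action:
`(x · F)(y) = d/dt F(y - t [x, y])` at `t = 0`. -/
def adjointAction : L →ₗ⁅ℂ⁆ Derivation ℂ (PolyFun L) (PolyFun L) where
  toFun x := vectorField (-LieAlgebra.ad ℂ L x)
  map_add' x y := derivation_ext fun l => by
    rw [Derivation.add_apply, vectorField_linear, vectorField_linear, vectorField_linear, ← map_add]
    congr 1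
    ext z
    simp only [LinearMap.comp_apply, LinearMap.neg_apply, LinearMap.add_apply, map_add, map_neg]
    ring
  map_smul' c x := derivation_ext fun l => by
    rw [RingHom.id_apply, Derivation.smul_apply, vectorField_linear, vectorField_linear, ← map_smul]
    congr 1
    ext z
    simp
  map_lie' {x y} := derivation_ext fun l => by
    rw [Derivation.commutator_apply]
    simp only [vectorField_linear]
    rw [← map_sub]
    congr 1
    ext z
    simp

/-- `ℂ[L]^L`: the algebra of polynomial functions on `L` invariant under the adjoint action. -/
def adjointInvariants : Subalgebra ℂ (PolyFun L) where
  carrier := {F | ∀ x : L, adjointAction L x F = 0}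
  mul_mem' {F G} hF hG x := by simp [hF x, hG x]
  add_mem' {F G} hF hG x := by simp [hF x, hG x]
  algebraMap_mem' r x := (adjointAction L x).map_algebraMap r

variable {L} in
/-- Restriction of polynomial functions from `L` to a subalgebra `H`. -/
def restrict (H : LieSubalgebra ℂ L) : PolyFun L →ₐ[ℂ] PolyFun H :=
  pullback H.toSubmodule.subtype

end Lie

section Weyl

variable {L : Type*} [LieRing L] [LieAlgebra ℂ L] [FiniteDimensional ℂ L]
  [LieAlgebra.IsSemisimple ℂ L] (H : LieSubalgebra ℂ L) [H.IsCartanSubalgebra]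

/-- The action of the Weyl group `W` on `ℂ[H]`, `(w · F)(h) = F(w⁻¹ h)`. Mathlib lets the Weyl
group act on the coweight space `H` from the right, so that `w⁻¹ h` is the map attached to `w`. -/
def weylAction : (LieAlgebra.IsKilling.rootSystem H).weylGroup →* (PolyFun H →ₐ[ℂ] PolyFun H) where
  toFun w := pullback (MulOpposite.unop
    (RootPairing.Equiv.coweightHom (LieAlgebra.IsKilling.rootSystem H) w)).toLinearMap
  map_one' := by
    rw [OneMemClass.coe_one, map_one]
    exact pullback_id
  map_mul' w₁ w₂ := by
    rw [MulMemClass.coe_mul, map_mul, MulOpposite.unop_mul]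
    exact pullback_mul _ _

/-- `ℂ[H]^W`: the algebra of polynomial functions on `H` invariant under the Weyl group. -/
def weylInvariants : Subalgebra ℂ (PolyFun H) where
  carrier := {F | ∀ w, weylAction H w F = F}
  mul_mem' {F G} hF hG w := by rw [map_mul, hF w, hG w]
  add_mem' {F G} hF hG w := by rw [map_add, hF w, hG w]
  algebraMap_mem' r w := (weylAction H w).commutes r

end Weyl

end

end ChevalleyRestriction

/-! No adjoint group is used: its action is replaced by explicit integral curves. An invariant F is
constant along any curve with c' = -[x, c], and three such curves of degree at most two, in the
directions e, f, e of an sl₂-triple, connect h to its reflection (`apply_reflection`). Since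
reflections generate W, restrictions are W-invariant.

Injectivity (`restrict_injective`): the k-th derivatives of an invariant F span a space stable under
L. If F vanishes on H, then inductively so do all these derivatives: tangentially to H this is
clear, and for a root vector x the relation α · ∂ₓG = x · G on H allows division by α. Hence every
derivative of F vanishes at 0.

Surjectivity (`exists_restrict_eq`): let R be the algebra of restrictions. It contains the power
sums ∑ αⁿ = tr (ad h)ⁿ, hence by Newton's identities the coefficients of ∏ (X - α). So the fraction
field of ℂ[H] is Galois over that of R, and each Galois automorphism permutes the roots, hence is
induced by a linear map s of H.

The crux is that s preserves every W-invariant f (`pullback_weylInvariant`). By density it suffices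
to treat h in the coroot lattice. Among finitely many points not separated from s h by W-invariants,
take x maximizing the Killing product with h; then x is dominant wherever h is. In the
representation generated by the wedge of the root vectors with α(h) > t, invariance of traces forces
h and x to have the same highest weight, i.e. ∑ α(h) = ∑ α(x) over those roots. Summing over t gives
κ(h, x) = κ(h, h). As κ(x, x) = κ(h, h) too, positivity on integral points yields x = h, so f(s h) =
f(h).

Thus f = Res F₁ / Res F₂ with F₁, F₂ invariant. Since f is integral over R, the quotient F₁ / F₂ is
integral over ℂ[L], hence a polynomial F; it restricts to f and is invariant by the Leibniz rule. -/

namespace ChevalleyRestriction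

noncomputable section

open Module

/-! ### Polynomial functions: coordinates, derivatives, vanishing criteria. -/

section PolyFun

variable {V U : Type*} [AddCommGroup V] [Module ℂ V] [AddCommGroup U] [Module ℂ U]

@[simp] theorem linearPart_apply (l : Dual ℂ V) (y : V) : (linearPart V l : V → ℂ) y = l y := rfl

@[simp] theorem pullback_apply (f : U →ₗ[ℂ] V) (F : PolyFun V) (y : U) :
    (pullback f F : U → ℂ) y = (F : V → ℂ) (f y) := rfl

theorem polyFun_ext {F G : PolyFun V} (h : ∀ y, (F : V → ℂ) y = (G : V → ℂ) y) : F = G :=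
  Subtype.ext (funext h)

/-- Evaluation of polynomial functions at a point. -/
def evalAt (y : V) : PolyFun V →ₐ[ℂ] ℂ :=
  (Pi.evalAlgHom ℂ (fun _ : V => ℂ) y).comp (PolyFun V).val

theorem evalAt_apply (y : V) (F : PolyFun V) : evalAt y F = (F : V → ℂ) y := rfl

@[simp] theorem polyFun_sum_apply {ι : Type*} (s : Finset ι) (F : ι → PolyFun V) (y : V) :
    ((∑ i ∈ s, F i : PolyFun V) : V → ℂ) y = ∑ i ∈ s, (F i : V → ℂ) y := by
  simp only [← evalAt_apply, map_sum]

@[elab_as_elim]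
theorem polyFun_induction {P : PolyFun V → Prop} (linear : ∀ l, P (linearPart V l))
    (const : ∀ r, P (algebraMap ℂ _ r)) (add : ∀ F G, P F → P G → P (F + G))
    (mul : ∀ F G, P F → P G → P (F * G)) (F : PolyFun V) : P F := by
  obtain ⟨F, hF⟩ := F
  induction hF using Algebra.adjoin_induction with
  | mem F hF =>
    obtain ⟨l, rfl⟩ := hF
    exact linear l
  | algebraMap r => exact const r
  | add F G hF hG h₁ h₂ => exact add _ _ h₁ h₂
  | mul F G hF hG h₁ h₂ => exact mul _ _ h₁ h₂

/-- The polynomial functions on `V` are the polynomials in the coordinates of a basis. -/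
def mvPolynomialEquiv {ι : Type*} [Finite ι] (b : Basis ι ℂ V) :
    MvPolynomial ι ℂ ≃ₐ[ℂ] PolyFun V :=
  AlgEquiv.ofBijective (MvPolynomial.aeval fun i => linearPart V (b.coord i)) <| by
    have key (p : MvPolynomial ι ℂ) (y : V) :
        (MvPolynomial.aeval (fun i => linearPart V (b.coord i)) p : PolyFun V).1 y =
          MvPolynomial.eval (fun i => b.coord i y) p := by
      rw [← evalAt_apply, MvPolynomial.comp_aeval_apply]
      rfl
    constructor
    · intro p q h
      refine MvPolynomial.funext fun x => ?_
      have := Fintype.ofFinite ι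
      have hx : (fun i => b.coord i (b.equivFun.symm x)) = x := by
        ext i
        rw [Basis.coord_apply, ← Basis.equivFun_apply, LinearEquiv.apply_symm_apply]
      have := congrArg (fun F : PolyFun V => F.1 (b.equivFun.symm x)) h
      simpa only [key, hx] using this
    · rw [← AlgHom.range_eq_top, eq_top_iff]
      rintro F -
      induction F using polyFun_induction with
      | linear l =>
        have := Fintype.ofFinite ι
        rw [← b.sum_dual_apply_smul_coord l, map_sum]
        refine sum_mem fun i _ => ?_
        rw [map_smul]
        exact Subalgebra.smul_mem _ (AlgHom.mem_range _ |>.2 ⟨.X i, MvPolynomial.aeval_X _ i⟩) _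
      | const r => exact Subalgebra.algebraMap_mem _ r
      | add F G h₁ h₂ => exact add_mem h₁ h₂
      | mul F G h₁ h₂ => exact mul_mem h₁ h₂

instance [FiniteDimensional ℂ V] : IsDomain (PolyFun V) :=
  (mvPolynomialEquiv (finBasis ℂ V)).symm.toMulEquiv.isDomain _

instance [FiniteDimensional ℂ V] : IsIntegrallyClosed (PolyFun V) :=
  IsIntegrallyClosed.of_equiv (mvPolynomialEquiv (finBasis ℂ V)).toRingEquiv

/-- The chain rule for a polynomial function along a curve that is differentiable coordinatewise. -/
theorem hasDerivAt_comp_curve (F : PolyFun V) {c : ℂ → V} {v : V} {t : ℂ}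
    (hc : ∀ l : Dual ℂ V, HasDerivAt (fun s => l (c s)) (l v) t) :
    HasDerivAt (fun s => (F : V → ℂ) (c s)) (lineDeriv ℂ (F : V → ℂ) (c t) v) t := by
  induction F using polyFun_induction with
  | linear l =>
    have : lineDeriv ℂ (linearPart V l : V → ℂ) (c t) v = l v := lineDeriv_linear l _ _
    rw [this]
    exact hc l
  | const r =>
    have : lineDeriv ℂ (algebraMap ℂ (PolyFun V) r : V → ℂ) (c t) v = 0 := deriv_const (0 : ℂ) r
    rw [this]
    exact hasDerivAt_const t r
  | add F G h₁ h₂ =>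
    have := h₁.add h₂
    rw [← lineDeriv_add F.2 G.2] at this
    exact this
  | mul F G h₁ h₂ =>
    have h : lineDeriv ℂ (F * G : PolyFun V).1 (c t) v = _ := lineDeriv_mul F.2 G.2 (c t) v
    rw [h, add_comm, mul_comm (G.1 _)]
    exact h₁.mul h₂

/-- The derivative of polynomial functions in the direction of a constant vector. -/
def constField (v : V) : Derivation ℂ (PolyFun V) (PolyFun V) :=
  Derivation.mk'
    { toFun := fun F => ⟨fun y => lineDeriv ℂ (F : V → ℂ) y v, by
        obtain ⟨F, hF⟩ := F
        change (fun y => lineDeriv ℂ F y v) ∈ PolyFun V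
        induction hF using Algebra.adjoin_induction with
        | mem F hF =>
          obtain ⟨l, rfl⟩ := hF
          simp only [lineDeriv_linear]
          exact (PolyFun V).algebraMap_mem (l v)
        | algebraMap r =>
          have : (fun y => lineDeriv ℂ (algebraMap ℂ (V → ℂ) r) y v) = 0 :=
            funext fun _ => deriv_const (0 : ℂ) r
          exact this ▸ (PolyFun V).zero_mem
        | add F G hF hG h₁ h₂ =>
          simp only [lineDeriv_add hF hG]
          exact add_mem h₁ h₂
        | mul F G hF hG h₁ h₂ =>
          simp only [lineDeriv_mul hF hG]
          exact add_mem (mul_mem hF h₂) (mul_mem hG h₁)⟩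
      map_add' := fun F G => Subtype.ext <| funext fun y => lineDeriv_add F.2 G.2 y v
      map_smul' := fun c F => Subtype.ext <| funext fun y =>
        deriv_const_smul c (lineDifferentiableAt F.2 y v) }
    fun F G => Subtype.ext <| funext fun y => lineDeriv_mul F.2 G.2 y v

theorem constField_linear (v : V) (l : Dual ℂ V) :
    constField v (linearPart V l) = algebraMap ℂ _ (l v) :=
  Subtype.ext <| funext fun y => lineDeriv_linear l y v

/-- A polynomial function is a polynomial along each line. -/
theorem exists_polynomial_line (F : PolyFun V) (x v : V) :
    ∃ p : Polynomial ℂ, ∀ t : ℂ, (F : V → ℂ) (x + t • v) = p.eval t := by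
  induction F using polyFun_induction with
  | linear l => exact ⟨.C (l x) + .X * .C (l v), fun t => by simp; ring⟩
  | const r => exact ⟨.C r, fun t => by rw [Polynomial.eval_C]; rfl⟩
  | add F G h₁ h₂ =>
    obtain ⟨p, hp⟩ := h₁
    obtain ⟨q, hq⟩ := h₂
    exact ⟨p + q, fun t => by rw [Polynomial.eval_add, ← hp, ← hq]; rfl⟩
  | mul F G h₁ h₂ =>
    obtain ⟨p, hp⟩ := h₁
    obtain ⟨q, hq⟩ := h₂
    exact ⟨p * q, fun t => by rw [Polynomial.eval_mul, ← hp, ← hq]; rfl⟩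

/-- A polynomial function all of whose derivatives vanish at the origin is zero. -/
theorem eq_zero_of_iterate_constField {F : PolyFun V}
    (h : ∀ v k, ((constField v)^[k] F : V → ℂ) 0 = 0) : F = 0 := by
  refine polyFun_ext fun v => ?_
  have key (k : ℕ) : ∀ (F : PolyFun V) (p : Polynomial ℂ),
      (∀ t : ℂ, (F : V → ℂ) (0 + t • v) = p.eval t) →
      ∀ t : ℂ, ((constField v)^[k] F : V → ℂ) (0 + t • v) = (Polynomial.derivative^[k] p).eval t := by
    induction k with
    | zero => exact fun F p h => h
    | succ k ih =>
      intro F p hp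
      rw [Function.iterate_succ_apply, Function.iterate_succ_apply]
      refine ih _ _ fun t => ?_
      have h₁ : HasDerivAt (fun s : ℂ => (F : V → ℂ) (0 + s • v))
          (lineDeriv ℂ (F : V → ℂ) (0 + t • v) v) t := hasDerivAt_comp_curve F fun l => by
        simpa using (hasDerivAt_id t).mul_const (l v)
      simp only [hp] at h₁
      exact h₁.unique (p.hasDerivAt t)
  obtain ⟨p, hp⟩ := exists_polynomial_line F 0 v
  -- Every Taylor coefficient of the restriction of F to the line through v vanishes, since k! is
  -- invertible.
  have hp0 : p = 0 := by
    ext k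
    have := key k F p hp 0
    rw [zero_smul, add_zero, h, ← Polynomial.coeff_zero_eq_eval_zero,
      Polynomial.coeff_iterate_derivative] at this
    simpa [Nat.descFactorial_self, Nat.factorial_ne_zero] using this.symm
  simpa [hp0] using hp 1

/-- A polynomial function vanishing on a subgroup that spans `V` is zero. -/
theorem eq_zero_of_forall_mem_addSubgroup {F : PolyFun V} {S : Set V} (hS : Submodule.span ℂ S = ⊤)
    (h : ∀ x ∈ AddSubgroup.closure S, (F : V → ℂ) x = 0) : F = 0 := by
  -- `G x` says that F vanishes on the coset of x. Along a generator u, F is a polynomial with all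
  -- integers as roots, so `G` survives translation by complex multiples of u.
  let G : V → Prop := fun x => ∀ y ∈ AddSubgroup.closure S, (F : V → ℂ) (x + y) = 0
  have step : ∀ u ∈ Submodule.span ℂ S, ∀ (c : ℂ) (x : V), G x → G (x + c • u) := by
    intro u hu
    induction hu using Submodule.span_induction with
    | mem u hu =>
      intro c x hx y hy
      obtain ⟨p, hp⟩ := exists_polynomial_line F (x + y) u
      have hp0 : p = 0 := by
        refine Polynomial.eq_zero_of_infinite_isRoot p
          ((Set.infinite_range_of_injective (Int.cast_injective (α := ℂ))).mono ?_)
        rintro _ ⟨n, rfl⟩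
        have := hx (y + n • u) (add_mem hy (zsmul_mem (AddSubgroup.subset_closure hu) n))
        rwa [← add_assoc, ← Int.cast_smul_eq_zsmul ℂ, hp] at this
      rw [add_right_comm, hp, hp0, Polynomial.eval_zero]
    | zero => simp
    | add u w _ _ h₁ h₂ =>
      intro c x hx
      rw [smul_add, ← add_assoc]
      exact h₂ c _ (h₁ c x hx)
    | smul a u _ h =>
      intro c x hx
      rw [smul_smul]
      exact h _ x hx
  refine polyFun_ext fun v => ?_
  have := step v (hS ▸ Submodule.mem_top) 1 0 (fun y hy => by rw [zero_add]; exact h y hy) 0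
    (zero_mem _)
  simpa using this

end PolyFun

/-! ### The grading by degree, read off from the scaling operator. -/

section Grading

variable {V U : Type*} [AddCommGroup V] [Module ℂ V] [AddCommGroup U] [Module ℂ U]

/-- The action `(s F)(y) = F(2 y)` of the scaling by `2` on polynomial functions. -/
def scaling : PolyFun V →ₐ[ℂ] PolyFun V := pullback ((2 : ℂ) • LinearMap.id)

@[simp] theorem scaling_apply (F : PolyFun V) (y : V) :
    (scaling F : V → ℂ) y = (F : V → ℂ) ((2 : ℂ) • y) := rfl

theorem scaling_of_mem_homogeneous {n : ℕ} {F : PolyFun V} (hF : F ∈ homogeneous V n) :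
    scaling F = (2 ^ n : ℂ) • F := by
  induction n generalizing F with
  | zero =>
    rw [homogeneous, pow_zero, Submodule.mem_one] at hF
    obtain ⟨r, rfl⟩ := hF
    rw [AlgHom.commutes, pow_zero, one_smul]
  | succ n ih =>
    rw [homogeneous, pow_succ] at hF
    induction hF using Submodule.mul_induction_on' with
    | mem_mul_mem G hG l hl =>
      obtain ⟨l, rfl⟩ := hl
      have hl : scaling (linearPart V l) = (2 : ℂ) • linearPart V l :=
        polyFun_ext fun y => by
          rw [scaling_apply, linearPart_apply, map_smul]
          rfl
      rw [map_mul, ih hG, hl, smul_mul_smul_comm, pow_succ]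
    | add F _ G _ h₁ h₂ => rw [map_add, h₁, h₂, smul_add]

theorem linearPart_mem_homogeneous (l : Dual ℂ V) : linearPart V l ∈ homogeneous V 1 := by
  rw [homogeneous, pow_one]
  exact ⟨l, rfl⟩

theorem iSup_homogeneous : ⨆ n, homogeneous V n = ⊤ := by
  rw [eq_top_iff]
  rintro F -
  induction F using polyFun_induction with
  | linear l => exact Submodule.mem_iSup_of_mem 1 (linearPart_mem_homogeneous l)
  | const r =>
    refine Submodule.mem_iSup_of_mem 0 ?_
    rw [homogeneous, pow_zero]
    exact Submodule.algebraMap_mem r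
  | add F G h₁ h₂ => exact add_mem h₁ h₂
  | mul F G h₁ h₂ =>
    have : F * G ∈ (⨆ n, homogeneous V n) * ⨆ n, homogeneous V n := Submodule.mul_mem_mul h₁ h₂
    rw [Submodule.iSup_mul] at this
    refine (iSup_le (fun m => ?_) : _ ≤ ⨆ n, homogeneous V n) this
    rw [Submodule.mul_iSup]
    refine iSup_le fun n => ?_
    rw [homogeneous, homogeneous, ← pow_add]
    exact le_iSup (homogeneous V) (m + n)

/-- The components of a vector with respect to eigenspaces lie in any stable submodule containing
the vector. -/
theorem mem_of_sum_eigenvectors {M ι : Type*} [AddCommGroup M] [Module ℂ M] {f : End ℂ M}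
    {p : Submodule ℂ M} (hp : ∀ x ∈ p, f x ∈ p) {μ : ι → ℂ} (hμ : Function.Injective μ)
    {s : Finset ι} {x : ι → M} (hx : ∀ i ∈ s, f (x i) = μ i • x i) (hs : ∑ i ∈ s, x i ∈ p)
    {i : ι} (hi : i ∈ s) : x i ∈ p := by
  classical
  have hq (q : Polynomial ℂ) : ∀ y ∈ p, Polynomial.aeval f q y ∈ p := by
    intro y hy
    induction q using Polynomial.induction_on' with
    | add q r h₁ h₂ => simpa using add_mem h₁ h₂
    | monomial n a =>
      rw [Polynomial.aeval_monomial]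
      refine p.smul_mem a ?_
      induction n with
      | zero => exact hy
      | succ n ih => rw [pow_succ']; exact hp _ ih
  have heig (q : Polynomial ℂ) (j : ι) (hj : j ∈ s) :
      Polynomial.aeval f q (x j) = q.eval (μ j) • x j := by
    induction q using Polynomial.induction_on' with
    | add q r h₁ h₂ => simp [h₁, h₂, add_smul]
    | monomial n a =>
      rw [Polynomial.aeval_monomial, Polynomial.eval_monomial, mul_smul]
      change a • (f ^ n) (x j) = _
      congr 1
      induction n with
      | zero => simp
      | succ n ih => rw [pow_succ', Module.End.mul_apply, ih, map_smul, hx j hj, smul_smul, pow_succ]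
  -- The Lagrange polynomial that is 1 at μ i and 0 at the other eigenvalues, applied to f, extracts
  -- the i-th component without leaving p.
  have := hq (Lagrange.basis s μ i) _ hs
  rw [map_sum, Finset.sum_congr rfl fun j hj => heig _ j hj, Finset.sum_eq_single_of_mem i hi,
    Lagrange.eval_basis_self hμ.injOn hi, one_smul] at this
  · exact this
  · intro j hj hji
    rw [Lagrange.eval_basis_of_ne hji.symm hj, zero_smul]

theorem two_pow_injective : Function.Injective fun n : ℕ => (2 ^ n : ℂ) := fun m n h => by
  have h' : (2 ^ m : ℂ) = 2 ^ n := h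
  exact Nat.pow_right_injective le_rfl (by exact_mod_cast h' : 2 ^ m = 2 ^ n)

/-- If `B` is the sum of subspaces `h n` on which an endomorphism `f` acts as `2 ^ n`, then any
subalgebra of `B` stable under `f` is the direct sum of its intersections with the `h n`. -/
theorem isInternal_comap_val {B : Type*} [CommRing B] [Algebra ℂ B] (A : Subalgebra ℂ B)
    (h : ℕ → Submodule ℂ B) (f : End ℂ B) (hf : ∀ n, ∀ F ∈ h n, f F = (2 ^ n : ℂ) • F)
    (hsum : ∀ F, ∃ (s : Finset ℕ) (G : ℕ → B), (∀ n, G n ∈ h n) ∧ ∑ n ∈ s, G n = F)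
    (hA : ∀ F ∈ A, f F ∈ A) :
    DirectSum.IsInternal fun n => (h n).comap A.val.toLinearMap := by
  refine DirectSum.isInternal_submodule_of_iSupIndep_of_iSup_eq_top ?_ ?_
  · let f' : End ℂ A := f.restrict (p := A.toSubmodule) (q := A.toSubmodule) hA
    refine (f'.eigenspaces_iSupIndep.comp two_pow_injective).mono fun n F hF => ?_
    rw [Function.comp_apply, End.mem_eigenspace_iff]
    exact Subtype.ext (hf n _ hF)
  · rw [eq_top_iff]
    rintro F -
    obtain ⟨s, G, hG, hF⟩ := hsum (F : B)
    have hGA : ∀ n ∈ s, G n ∈ A := fun n hn =>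
      mem_of_sum_eigenvectors (p := A.toSubmodule) hA
        two_pow_injective (fun i _ => hf i _ (hG i)) (hF ▸ F.2) hn
    have : F = ∑ n : s, ⟨G n, hGA n n.2⟩ := by
      refine Subtype.ext ?_
      rw [AddSubmonoidClass.coe_finsetSum, ← hF, ← Finset.sum_coe_sort]
    rw [this]
    exact sum_mem fun n _ => Submodule.mem_iSup_of_mem n.1 (hG n)

theorem exists_sum_homogeneous (F : PolyFun V) :
    ∃ (s : Finset ℕ) (G : ℕ → PolyFun V), (∀ n, G n ∈ homogeneous V n) ∧ ∑ n ∈ s, G n = F := by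
  have hF : F ∈ ⨆ n, homogeneous V n := iSup_homogeneous (V := V) ▸ Submodule.mem_top
  obtain ⟨f, hf, rfl⟩ := (Submodule.mem_iSup_iff_exists_finsupp _ F).1 hF
  exact ⟨f.support, f, hf, rfl⟩

/-- Since the numbers 2ⁿ are distinct, one operator detects the degree. Anything commuting with
`scaling` therefore respects the grading. -/
theorem mem_homogeneous_iff {n : ℕ} {F : PolyFun V} :
    F ∈ homogeneous V n ↔ scaling F = (2 ^ n : ℂ) • F := by
  refine ⟨scaling_of_mem_homogeneous, fun hF => ?_⟩
  obtain ⟨s, G, hG, rfl⟩ := exists_sum_homogeneous F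
  refine sum_mem fun m hm => ?_
  have hmem : G m ∈ End.eigenspace (scaling (V := V)).toLinearMap (2 ^ n : ℂ) := by
    refine mem_of_sum_eigenvectors (f := (scaling (V := V)).toLinearMap) (fun x hx => ?_)
      two_pow_injective (fun i _ => scaling_of_mem_homogeneous (hG i)) ?_ hm
    · rw [End.mem_eigenspace_iff] at hx ⊢
      rw [hx, map_smul, hx]
    · exact End.mem_eigenspace_iff.2 hF
  have h₁ : scaling (G m) = (2 ^ n : ℂ) • G m := End.mem_eigenspace_iff.1 hmem
  rw [scaling_of_mem_homogeneous (hG m)] at h₁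
  by_cases h : G m = 0
  · rw [h]
    exact zero_mem _
  · exact two_pow_injective (smul_left_injective ℂ h h₁) ▸ hG m

/-- A subalgebra of `ℂ[V]` stable under scaling is graded by degree. -/
theorem nonempty_gradedAlgebra {A : Subalgebra ℂ (PolyFun V)} (hA : ∀ F ∈ A, scaling F ∈ A) :
    Nonempty (GradedAlgebra (degreePart A)) := by
  have hmul : SetLike.GradedMonoid (degreePart A) :=
    { one_mem := by
        change (1 : PolyFun V) ∈ homogeneous V 0
        rw [homogeneous, pow_zero]
        exact Submodule.one_le.1 le_rfl
      mul_mem := fun m n F G hF hG => by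
        change (F * G : PolyFun V) ∈ homogeneous V (m + n)
        rw [homogeneous, pow_add]
        exact Submodule.mul_mem_mul hF hG }
  have hint : DirectSum.IsInternal (degreePart A) :=
    isInternal_comap_val A (homogeneous V) (scaling (V := V)).toLinearMap
      (fun _ _ => scaling_of_mem_homogeneous) exists_sum_homogeneous hA
  exact ⟨{ hmul, hint.chooseDecomposition with }⟩

theorem scaling_pullback (f : U →ₗ[ℂ] V) (F : PolyFun V) :
    scaling (pullback f F) = pullback f (scaling F) :=
  polyFun_ext fun y => by simp

theorem finiteDimensional_homogeneous [FiniteDimensional ℂ V] (n : ℕ) :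
    FiniteDimensional ℂ (homogeneous V n) := by
  refine Module.Finite.iff_fg.2 (Submodule.FG.pow ?_ n)
  exact Module.Finite.iff_fg.1 inferInstance

end Grading

/-! ### Invariants along integral curves of the adjoint action. -/

section Invariance

variable {L : Type*} [LieRing L] [LieAlgebra ℂ L]

theorem adjointAction_apply (x : L) (F : PolyFun L) (y : L) :
    (adjointAction L x F : L → ℂ) y = lineDeriv ℂ (F : L → ℂ) y (-⁅x, y⁆) := rfl

/-- An invariant polynomial is constant along quadratic integral curves of the adjoint action. -/
theorem apply_quadratic_curve {F : PolyFun L} (hF : F ∈ adjointInvariants L) (x u₀ u₁ u₂ : L)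
    (h₀ : u₁ = -⁅x, u₀⁆) (h₁ : (2 : ℂ) • u₂ = -⁅x, u₁⁆) (h₂ : ⁅x, u₂⁆ = 0) :
    (F : L → ℂ) (u₀ + u₁ + u₂) = (F : L → ℂ) u₀ := by
  -- The three hypotheses say exactly that c' = -[x, c], so the derivative of F along c is x · F =
  -- 0.
  let c : ℂ → L := fun t => u₀ + t • u₁ + t ^ 2 • u₂
  have hc (t : ℂ) : HasDerivAt (fun s => (F : L → ℂ) (c s)) 0 t := by
    have h := hasDerivAt_comp_curve F (c := c) (v := -⁅x, c t⁆) (t := t) fun l => by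
      have h3 : -⁅x, c t⁆ = u₁ + (2 * t) • u₂ := by
        simp only [c, lie_add, lie_smul, h₂, smul_zero, add_zero, neg_add, ← h₀, ← smul_neg, ← h₁,
          smul_smul, mul_comm]
      have h4 : HasDerivAt (fun s : ℂ => l u₀ + s * l u₁ + s ^ 2 * l u₂)
          (0 + 1 * l u₁ + (2 * t) * l u₂) t := by
        refine ((hasDerivAt_const t _).add ((hasDerivAt_id t).mul_const _)).add ?_
        simpa using (hasDerivAt_pow 2 t).mul_const (l u₂)
      rw [h3]
      simpa [c] using h4
    rw [← adjointAction_apply, hF x] at h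
    exact h
  have := is_const_of_deriv_eq_zero (fun t => (hc t).differentiableAt) (fun t => (hc t).deriv) 1 0
  simpa [c] using this

end Invariance

/-! ### Restrictions of invariants are Weyl group invariant. -/

section Semisimple

open LieAlgebra LieAlgebra.IsKilling LieModule

/-- A subspace containing the Cartan subalgebra and the root spaces is everything. -/
theorem eq_top_of_rootSpace_le {L : Type*} [LieRing L] [LieAlgebra ℂ L] [FiniteDimensional ℂ L]
    {H : LieSubalgebra ℂ L} [H.IsCartanSubalgebra] {p : Submodule ℂ L} (hH : ∀ h : H, (h : L) ∈ p)
    (hα : ∀ α : Weight ℂ H L, α.IsNonZero → ∀ x ∈ rootSpace H α, x ∈ p) : p = ⊤ := by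
  rw [eq_top_iff]
  have := congrArg LieSubmodule.toSubmodule (iSup_genWeightSpace_eq_top' ℂ H L)
  rw [LieSubmodule.iSup_toSubmodule, LieSubmodule.top_toSubmodule] at this
  rw [← this, iSup_le_iff]
  intro α x hx
  by_cases h : α.IsZero
  · have hx' : x ∈ rootSpace H (0 : H → ℂ) := h ▸ hx
    rw [rootSpace_zero_eq] at hx'
    exact hH ⟨x, hx'⟩
  · exact hα α h x hx

variable {L : Type*} [LieRing L] [LieAlgebra ℂ L] [FiniteDimensional ℂ L]
  [LieAlgebra.IsSemisimple ℂ L] {H : LieSubalgebra ℂ L} [H.IsCartanSubalgebra]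

theorem lie_rootVector {α : H → ℂ} {x : L} (hx : x ∈ rootSpace H α) (h : H) :
    ⁅(h : L), x⁆ = α h • x := lie_eq_smul_of_mem_rootSpace hx h

theorem apply_sub_rootVector {F : PolyFun L} (hF : F ∈ adjointInvariants L)
    {α : Weight ℂ H L} {e : L} (he : e ∈ rootSpace H α) (h : H) :
    (F : L → ℂ) (h - α h • e) = (F : L → ℂ) h := by
  have key : ⁅e, (h : L)⁆ = -(α h • e) := by rw [← lie_skew, lie_rootVector he]
  have := apply_quadratic_curve hF (-e) h (-(α h • e)) 0 (by simp [key]) (by simp) (by simp)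
  simpa [sub_eq_add_neg] using this

/-- An invariant polynomial takes the same value at `h` and at its reflection in a root. -/
theorem apply_reflection {F : PolyFun L} (hF : F ∈ adjointInvariants L)
    {α : Weight ℂ H L} (hα : α.IsNonZero) (h : H) :
    (F : L → ℂ) (h - α h • coroot α : H) = (F : L → ℂ) h := by
  obtain ⟨k, e, f, ht, he, hf⟩ := exists_isSl2Triple_of_weight_isNonZero hα
  have hk := ht.h_eq_coroot hα he hf
  have hfh : ⁅f, (h : L)⁆ = α h • f := by
    rw [← lie_skew, lie_rootVector hf]
    simp
  have hfe : ⁅f, e⁆ = -k := by rw [← lie_skew, ht.lie_e_f]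
  have hfk : ⁅f, k⁆ = (2 : ℂ) • f := by
    rw [← lie_skew, ht.lie_h_f_nsmul, neg_neg, two_smul, two_smul]
  -- Starting from h - α(h) e, the flow of f ends at s h - α(h) e, where s is the reflection. The
  -- point s h flows to the same place along -e, because α(s h) = -α(h).
  have h₁ := apply_quadratic_curve hF f (h - α h • e) (-(α h • k) - α h • f) (α h • f)
    (by
      simp only [lie_sub, lie_smul, hfh, hfe]
      module)
    (by
      simp only [lie_sub, lie_smul, lie_neg, hfk, lie_self]
      module)
    (by simp)
  have h₂ := apply_sub_rootVector hF (neg_mem he : -e ∈ rootSpace H α) (h - α h • coroot α)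
  rw [apply_sub_rootVector hF he h] at h₁
  rw [← h₁, ← h₂]
  have : α (h - α h • coroot α) = -α h := by
    have h3 : α (h - α h • coroot α) = α h - α h * α (coroot α) := by
      rw [← Weight.toLinear_apply, map_sub, map_smul]
      rfl
    rw [h3, root_apply_coroot hα]
    ring
  have hc : ((h - α h • coroot α : H) : L) = h - α h • k := by rw [hk]; rfl
  rw [this, hc]
  refine congrArg (F : L → ℂ) ?_
  module

/-- The reflections in the roots generate W. -/
theorem mem_weylInvariants_iff {f : PolyFun H} :
    f ∈ weylInvariants H ↔ ∀ α : Weight ℂ H L, α.IsNonZero → ∀ h : H,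
      (f : H → ℂ) (h - α h • coroot α) = (f : H → ℂ) h := by
  constructor
  · intro hf α hα h
    have := hf (RootPairing.weylGroup.ofIdx _ (⟨α, by simpa using hα⟩ : H.root))
    exact congrArg (fun g : PolyFun H => (g : H → ℂ) h) this
  · rintro hf ⟨w, hw⟩
    induction hw using RootPairing.weylGroup.induction with
    | mem α => exact polyFun_ext fun h => hf α (H.isNonZero_coe_root α) h
    | one =>
      have := map_one (weylAction H)
      exact congrArg (fun g => g f) this
    | mul x y hx hy h₁ h₂ =>
      have := map_mul (weylAction H) ⟨x, hx⟩ ⟨y, hy⟩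
      have h3 := congrArg (fun g => g f) this
      refine h3.trans ?_
      rw [AlgHom.mul_apply, h₂, h₁]

theorem restrict_mem_weylInvariants {F : PolyFun L} (hF : F ∈ adjointInvariants L) :
    restrict H F ∈ weylInvariants H :=
  mem_weylInvariants_iff.2 fun _ hα h => apply_reflection hF hα h

end Semisimple

/-! ### Injectivity of restriction. -/

section Injectivity

variable {V : Type*} [AddCommGroup V] [Module ℂ V]

/-- `constField` as a linear map. -/
def constFieldLinear : V →ₗ[ℂ] Derivation ℂ (PolyFun V) (PolyFun V) where
  toFun := constField
  map_add' v w := derivation_ext fun l => by simp [constField_linear]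
  map_smul' c v := derivation_ext fun l => by simp [constField_linear, Algebra.smul_def]

variable {L : Type*} [LieRing L] [LieAlgebra ℂ L]

theorem adjointAction_linear (x : L) (l : Dual ℂ L) :
    adjointAction L x (linearPart L l) = linearPart L (l ∘ₗ (-LieAlgebra.ad ℂ L x)) :=
  vectorField_linear _ l

/-- The commutator of the two derivations is differentiation along [x, v], as one checks on linear
functionals. This keeps the span of the k-th derivatives of an invariant stable under L. -/
theorem adjointAction_constField (x v : L) (F : PolyFun L) :
    adjointAction L x (constField v F) =
      constField v (adjointAction L x F) + constField ⁅x, v⁆ F := by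
  have : ⁅adjointAction L x, constField v⁆ = constField ⁅x, v⁆ := derivation_ext fun l => by
    rw [Derivation.commutator_apply, constField_linear, adjointAction_linear, constField_linear,
      constField_linear, Derivation.map_algebraMap]
    simp
  have h := congrArg (fun D => D F) this
  simp only [Derivation.commutator_apply] at h
  rw [← h]
  abel

/-- The span of the `k`-th order derivatives of `F`. -/
def derivatives (F : PolyFun V) : ℕ → Submodule ℂ (PolyFun V)
  | 0 => Submodule.span ℂ {F}
  | k + 1 => ⨆ v : V, (derivatives F k).map (constField v).toLinearMap

theorem iterate_constField_mem_derivatives (F : PolyFun V) (v : V) (k : ℕ) :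
    (constField v)^[k] F ∈ derivatives F k := by
  induction k with
  | zero => exact Submodule.mem_span_singleton_self F
  | succ k ih =>
    rw [Function.iterate_succ_apply']
    exact Submodule.mem_iSup_of_mem v ⟨_, ih, rfl⟩

theorem adjointAction_mem_derivatives {F : PolyFun L} (hF : F ∈ adjointInvariants L) (x : L)
    (k : ℕ) : ∀ G ∈ derivatives F k, adjointAction L x G ∈ derivatives F k := by
  induction k with
  | zero =>
    intro G hG
    obtain ⟨c, rfl⟩ := Submodule.mem_span_singleton.1 hG
    rw [Derivation.map_smul, hF x, smul_zero]
    exact zero_mem _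
  | succ k ih =>
    suffices derivatives F (k + 1) ≤
        (derivatives F (k + 1)).comap (adjointAction L x).toLinearMap from this
    refine iSup_le fun v => ?_
    rintro _ ⟨G, hG, rfl⟩
    change adjointAction L x (constField v G) ∈ derivatives F (k + 1)
    rw [adjointAction_constField]
    exact add_mem (Submodule.mem_iSup_of_mem v ⟨_, ih G hG, rfl⟩)
      (Submodule.mem_iSup_of_mem ⁅x, v⁆ ⟨_, hG, rfl⟩)

theorem constField_smul_apply (c : ℂ) (v : V) (F : PolyFun V) (y : V) :
    (constField (c • v) F : V → ℂ) y = c * (constField v F : V → ℂ) y := by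
  have : constField (c • v) = c • constField v := constFieldLinear.map_smul c v
  rw [this]
  rfl

variable [FiniteDimensional ℂ L] [LieAlgebra.IsSemisimple ℂ L] {H : LieSubalgebra ℂ L}
  [H.IsCartanSubalgebra]

open LieAlgebra LieAlgebra.IsKilling LieModule

/-- Directions in H are tangent to the zero set. For a root vector x one has -[x, h] = α(h) x, so α
· ∂ₓG = x · G = 0 on H, and α cancels in the domain ℂ[H]. -/
theorem restrict_constField_eq_zero {G : PolyFun L} (hG : restrict H G = 0)
    (hx : ∀ x, restrict H (adjointAction L x G) = 0) (v : L) :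
    restrict H (constField v G) = 0 := by
  let p : Submodule ℂ L :=
    { carrier := {v | restrict H (constField v G) = 0}
      add_mem' := fun {v w} hv hw => by
        have : constField (v + w) = constField v + constField w := constFieldLinear.map_add v w
        rw [Set.mem_ofPred_eq] at hv hw ⊢
        rw [this, Derivation.add_apply, map_add, hv, hw, add_zero]
      zero_mem' := by
        have : constField (0 : L) = 0 := constFieldLinear.map_zero
        rw [Set.mem_ofPred_eq, this, Derivation.zero_apply, map_zero]
      smul_mem' := fun c v hv => by
        have : constField (c • v) = c • constField v := constFieldLinear.map_smul c v
        rw [Set.mem_ofPred_eq] at hv ⊢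
        rw [this, Derivation.smul_apply, map_smul, hv, smul_zero] }
  have hp : p = ⊤ := by
    refine eq_top_of_rootSpace_le (H := H) (fun h => polyFun_ext fun y => ?_) fun α hα x hxα => ?_
    · have h0 (t : ℂ) : (G : L → ℂ) (y + t • h) = 0 :=
        congrArg (fun g : PolyFun H => (g : H → ℂ) (y + t • h)) hG
      change deriv (fun t : ℂ => (G : L → ℂ) (y + t • h)) 0 = 0
      simp only [h0, deriv_const]
    · have hmul : linearPart H α.toLinear * restrict H (constField x G) = 0 := by
        rw [← hx x]
        refine polyFun_ext fun h => ?_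
        change α h * (constField x G : L → ℂ) h = (constField (-⁅x, (h : L)⁆) G : L → ℂ) h
        rw [lie_skew, lie_rootVector hxα, constField_smul_apply]
      refine (mul_eq_zero.1 hmul).resolve_left fun h0 => hα ?_
      exact funext fun h => congrArg (fun g : PolyFun H => (g : H → ℂ) h) h0
  exact (hp ▸ Submodule.mem_top : v ∈ p)

theorem restrict_injective {F : PolyFun L} (hF : F ∈ adjointInvariants L)
    (h : restrict H F = 0) : F = 0 := by
  have key (k : ℕ) : ∀ G ∈ derivatives F k, restrict H G = 0 := by
    induction k with
    | zero =>
      intro G hG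
      obtain ⟨c, rfl⟩ := Submodule.mem_span_singleton.1 hG
      rw [map_smul, h, smul_zero]
    | succ k ih =>
      suffices derivatives F (k + 1) ≤ LinearMap.ker (restrict H).toLinearMap from this
      refine iSup_le fun v => ?_
      rintro _ ⟨G, hG, rfl⟩
      exact restrict_constField_eq_zero (ih G hG)
        (fun x => ih _ (adjointAction_mem_derivatives hF x k G hG)) v
  refine eq_zero_of_iterate_constField fun v k => ?_
  have := key k _ (iterate_constField_mem_derivatives F v k)
  exact congrArg (fun g : PolyFun H => (g : H → ℂ) 0) this

end Injectivity

/-! ### Traces of powers: eigenvalues and invariant polynomials. -/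

section Trace

open Polynomial in
/-- Over `ℂ`, the traces of the powers of an endomorphism determine its eigenvalues. -/
theorem hasEigenvalue_of_trace_pow_eq {M : Type*} [AddCommGroup M] [Module ℂ M]
    [FiniteDimensional ℂ M] {A B : End ℂ M}
    (h : ∀ n : ℕ, LinearMap.trace ℂ M (A ^ n) = LinearMap.trace ℂ M (B ^ n)) {a : ℂ}
    (ha : A.HasEigenvalue a) : B.HasEigenvalue a := by
  have htr (p : ℂ[X]) : LinearMap.trace ℂ M (aeval A p) = LinearMap.trace ℂ M (aeval B p) := by
    induction p using Polynomial.induction_on' with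
    | add p q h₁ h₂ => simp only [map_add, h₁, h₂]
    | monomial n c =>
      simp only [aeval_monomial, ← Algebra.smul_def, map_smul, h]
  by_contra hB
  have hinj : Function.Injective (B - algebraMap ℂ (End ℂ M) a) := by
    rw [← LinearMap.ker_eq_bot]
    by_contra hk
    exact hB (by rwa [End.hasEigenvalue_iff, End.eigenspace_def])
  have hne : A.charpoly * B.charpoly ≠ 0 :=
    mul_ne_zero A.charpoly_monic.ne_zero B.charpoly_monic.ne_zero
  obtain ⟨q, hq, hdvd⟩ :=
    (A.charpoly * B.charpoly).exists_eq_pow_rootMultiplicity_mul_and_not_dvd hne a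
  set N := (A.charpoly * B.charpoly).rootMultiplicity a with hN
  have hN0 : N ≠ 0 := by
    have : (A.charpoly * B.charpoly).IsRoot a := by
      rw [IsRoot, eval_mul, (End.hasEigenvalue_iff_isRoot_charpoly A a).1 ha, zero_mul]
    exact ((rootMultiplicity_pos hne).2 this).ne'
  obtain ⟨u, w, huw⟩ : IsCoprime ((X - C a) ^ N) q :=
    ((irreducible_X_sub_C a).coprime_iff_not_dvd.2 hdvd).pow_left
  have hX (T : End ℂ M) : aeval T (X - C a) = T - algebraMap ℂ _ a := by simp
  -- The product of the characteristic polynomials kills B, and the factor B - a is injective by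
  -- assumption.
  have hqB : aeval B q = 0 := by
    have h0 : (B - algebraMap ℂ (End ℂ M) a) ^ N * aeval B q = 0 := by
      rw [← hX, ← map_pow, ← map_mul, ← hq, map_mul, LinearMap.aeval_self_charpoly, mul_zero]
    refine LinearMap.ext fun y => ?_
    have := LinearMap.congr_fun h0 y
    rw [End.mul_apply, End.coe_pow] at this
    refine hinj.iterate N (this.trans ?_)
    rw [← End.coe_pow]
    simp
  -- w q is 1 modulo (X - a)^N and 0 modulo q, so on A it gives the projection to the generalized
  -- eigenspace of a. Its trace can be computed on B, where it is 0; an idempotent of trace 0 in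
  -- characteristic 0 vanishes.
  have hidem : IsIdempotentElem (aeval A (w * q)) := by
    have h1 : w * q * (w * q) = w * q - w * u * ((X - C a) ^ N * q) := by
      linear_combination (w * q) * huw
    rw [IsIdempotentElem, ← map_mul, h1, ← hq]
    simp [LinearMap.aeval_self_charpoly]
  have hz : aeval A (w * q) = 0 := by
    refine LinearMap.IsIdempotentElem.eq_zero_of_trace_eq_zero hidem ?_
    rw [htr, map_mul, hqB, mul_zero, map_zero]
  obtain ⟨x, hx⟩ := ha.exists_hasEigenvector
  refine hx.2 ?_
  have h1 : aeval A (u * (X - C a) ^ N + w * q) x = x := by rw [huw]; simp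
  rw [map_add, hz, add_zero, map_mul, map_pow, hX, End.mul_apply, ← Nat.succ_pred hN0, pow_succ,
    End.mul_apply, LinearMap.sub_apply, hx.apply_eq_smul] at h1
  simpa using h1.symm

variable {L M : Type*} [LieRing L] [LieAlgebra ℂ L] [AddCommGroup M] [Module ℂ M]
  [FiniteDimensional ℂ M]

/-- The functions `y ↦ φ (ρ(y) ^ n)` attached to a representation `ρ` are polynomial, and the
adjoint action on them is by commutators. -/
theorem exists_polyFun_apply_pow (ρ : L →ₗ[ℂ] End ℂ M)
    (hρ : ∀ x y, ρ ⁅x, y⁆ = ρ x * ρ y - ρ y * ρ x) (n : ℕ) : ∀ φ : Dual ℂ (End ℂ M),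
    ∃ F : PolyFun L, (∀ y, (F : L → ℂ) y = φ (ρ y ^ n)) ∧
      ∀ x y, (adjointAction L x F : L → ℂ) y = φ (ρ y ^ n * ρ x - ρ x * ρ y ^ n) := by
  induction n with
  | zero =>
    refine fun φ => ⟨algebraMap ℂ _ (φ 1), fun y => rfl, fun x y => ?_⟩
    rw [Derivation.map_algebraMap]
    simp
  | succ n ih =>
    intro φ
    -- Expanding the last factor ρ y in a basis moves the basis vectors into φ; hence the induction
    -- over all φ at once.
    let b := finBasis ℂ (End ℂ M)
    have hb (P Z : End ℂ M) : φ (P * Z) = ∑ k, b.coord k Z * φ (P * b k) := by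
      conv_lhs => rw [← b.sum_repr Z, Finset.mul_sum, map_sum]
      refine Finset.sum_congr rfl fun k _ => ?_
      rw [mul_smul_comm, map_smul, smul_eq_mul, Basis.coord_apply]
    choose G hG hGx using fun k => ih (φ ∘ₗ LinearMap.mulRight ℂ (b k))
    refine ⟨∑ k, linearPart L (b.coord k ∘ₗ ρ) * G k, fun y => ?_, fun x y => ?_⟩
    · rw [polyFun_sum_apply, pow_succ, hb]
      exact Finset.sum_congr rfl fun k _ => congrArg (b.coord k (ρ y) * ·) (hG k y)
    · have h1 : ρ y ^ (n + 1) * ρ x - ρ x * ρ y ^ (n + 1) =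
          (ρ y ^ n * ρ x - ρ x * ρ y ^ n) * ρ y + ρ y ^ n * -ρ ⁅x, y⁆ := by
        rw [hρ, pow_succ]
        noncomm_ring
      rw [map_sum, polyFun_sum_apply, h1, map_add, hb, hb, ← Finset.sum_add_distrib]
      refine Finset.sum_congr rfl fun k _ => ?_
      rw [Derivation.leibniz, adjointAction_linear]
      change b.coord k (ρ y) * (adjointAction L x (G k) : L → ℂ) y +
        (G k : L → ℂ) y * b.coord k (ρ (-⁅x, y⁆)) = _
      rw [hGx, hG, map_neg, mul_comm (φ.comp _ _)]
      rfl

/-- The functions `y ↦ tr (ρ(y) ^ n)` attached to a representation `ρ` are invariant. -/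
theorem exists_adjointInvariant_trace_pow (ρ : L →ₗ[ℂ] End ℂ M)
    (hρ : ∀ x y, ρ ⁅x, y⁆ = ρ x * ρ y - ρ y * ρ x) (n : ℕ) :
    ∃ F ∈ adjointInvariants L, ∀ y, (F : L → ℂ) y = LinearMap.trace ℂ M (ρ y ^ n) := by
  obtain ⟨F, hF, hFx⟩ := exists_polyFun_apply_pow ρ hρ n (LinearMap.trace ℂ M)
  refine ⟨F, fun x => polyFun_ext fun y => ?_, hF⟩
  rw [hFx, map_sub, LinearMap.trace_mul_comm, sub_self]
  rfl

end Trace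

/-! ### From power sums to elementary symmetric functions. -/

section Newton

open MvPolynomial in
/-- Over `ℂ`, the elementary symmetric functions are polynomials in the power sums. -/
theorem aeval_esymm_mem {B ι : Type*} [CommRing B] [Algebra ℂ B] [Fintype ι] {R : Subalgebra ℂ B}
    {a : ι → B} (h : ∀ n, n ≠ 0 → ∑ i, a i ^ n ∈ R) (k : ℕ) : aeval a (esymm ι ℂ k) ∈ R := by
  induction k using Nat.strong_induction_on with
  | _ k ih =>
    rcases eq_or_ne k 0 with rfl | hk
    · simp
    -- Newton's identity writes k · eₖ through eⱼ with j < k and power sums of positive exponent; k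
    -- is invertible in ℂ.
    have h1 := congrArg (aeval a) (mul_esymm_eq_sum ι ℂ k)
    rw [map_mul, map_natCast] at h1
    have h2 : (k : B) * aeval a (esymm ι ℂ k) ∈ R := by
      rw [h1, map_mul, map_sum]
      refine mul_mem (by rw [map_pow, map_neg, map_one]; exact pow_mem (neg_mem (one_mem _)) _)
        (sum_mem fun p hp => ?_)
      rw [Finset.mem_filter, Finset.HasAntidiagonal.mem_antidiagonal] at hp
      rw [map_mul, map_mul, map_pow, map_neg, map_one]
      refine mul_mem (mul_mem (pow_mem (neg_mem (one_mem _)) _) (ih _ hp.2)) ?_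
      have : aeval a (psum ι ℂ p.2) = ∑ i, a i ^ p.2 := by simp [psum]
      rw [this]
      exact h _ (by omega)
    have h3 : aeval a (esymm ι ℂ k) = (k : ℂ)⁻¹ • ((k : B) * aeval a (esymm ι ℂ k)) := by
      rw [← map_natCast (algebraMap ℂ B), ← Algebra.smul_def, smul_smul,
        inv_mul_cancel₀ (Nat.cast_ne_zero.2 hk), one_smul]
    rw [h3]
    exact R.smul_mem h2 _

open Polynomial in
theorem coeff_prod_X_sub_C_mem {B ι : Type*} [CommRing B] [Algebra ℂ B] [Fintype ι]
    {R : Subalgebra ℂ B} {a : ι → B} (h : ∀ n, n ≠ 0 → ∑ i, a i ^ n ∈ R) (k : ℕ) :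
    (∏ i, (X - C (a i))).coeff k ∈ R := by
  have hprod : ∏ i, (X - C (a i)) =
      ((Finset.univ.val.map a).map fun t => X - C t).prod := by
    rw [Multiset.map_map]
    rfl
  by_cases hk : k ≤ Fintype.card ι
  · rw [hprod, Multiset.prod_X_sub_C_coeff _ (by simpa using hk),
      ← MvPolynomial.aeval_esymm_eq_multiset_esymm ι ℂ]
    exact mul_mem (pow_mem (neg_mem (one_mem _)) _) (aeval_esymm_mem h _)
  · rw [coeff_eq_zero_of_natDegree_lt]
    · exact zero_mem _
    · refine lt_of_le_of_lt (natDegree_prod_le _ _) ?_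
      refine lt_of_le_of_lt (Finset.sum_le_sum fun i _ => natDegree_X_sub_C_le (a i)) ?_
      simpa using hk

end Newton

/-! ### Power sums of the roots as restricted invariants. -/

section AdTrace

open LieAlgebra LieAlgebra.IsKilling LieModule

variable {L : Type*} [LieRing L] [LieAlgebra ℂ L] [FiniteDimensional ℂ L]
  [LieAlgebra.IsSemisimple ℂ L] {H : LieSubalgebra ℂ L} [H.IsCartanSubalgebra]

/-- Root spaces are lines on which ad h is scalar. The zero weight space contributes 0ⁿ times its
dimension, which disappears only for n ≠ 0. -/
theorem trace_ad_pow (h : H) {n : ℕ} (hn : n ≠ 0) :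
    LinearMap.trace ℂ L (ad ℂ L h ^ n) = ∑ α : H.root, (α : Weight ℂ H L) h ^ n := by
  classical
  have hpow (χ : Weight ℂ H L) (x : L) (hx : x ∈ rootSpace H χ) :
      (ad ℂ L h ^ n) x = χ h ^ n • x := by
    clear hn
    induction n with
    | zero => simp
    | succ n ih =>
      rw [pow_succ', End.mul_apply, ih, map_smul, ad_apply, lie_rootVector hx, smul_smul, pow_succ]
  have hds := DirectSum.isInternal_submodule_of_iSupIndep_of_iSup_eq_top
    (LieSubmodule.iSupIndep_toSubmodule.mpr <| iSupIndep_genWeightSpace' ℂ H L)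
    (LieSubmodule.iSup_toSubmodule_eq_top.mpr <| iSup_genWeightSpace_eq_top' ℂ H L)
  have hmaps (χ : Weight ℂ H L) :
      Set.MapsTo (ad ℂ L h ^ n) (genWeightSpace L χ).toSubmodule (genWeightSpace L χ).toSubmodule :=
    fun x hx => by
      rw [hpow χ x hx]
      exact Submodule.smul_mem _ _ hx
  rw [LinearMap.trace_eq_sum_trace_restrict hds hmaps]
  have hres (χ : Weight ℂ H L) :
      LinearMap.trace ℂ _ ((ad ℂ L h ^ n).restrict (hmaps χ)) =
        χ h ^ n * finrank ℂ (rootSpace H χ) := by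
    have : (ad ℂ L h ^ n).restrict (hmaps χ) = χ h ^ n • LinearMap.id :=
      LinearMap.ext fun x => Subtype.ext (hpow χ x x.2)
    rw [this, map_smul, LinearMap.trace_id, smul_eq_mul]
    rfl
  simp_rw [hres]
  rw [← Finset.sum_subset (Finset.subset_univ H.root), ← Finset.sum_coe_sort]
  · refine Finset.sum_congr rfl fun α _ => ?_
    rw [finrank_rootSpace_eq_one _ (H.isNonZero_coe_root α), Nat.cast_one, mul_one]
  · intro χ _ hχ
    have : χ.IsZero := by simpa using hχ
    have h0 : χ h = 0 := congrFun this h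
    rw [h0, zero_pow hn, zero_mul]

variable (H) in
/-- The algebra of the restrictions to `H` of the invariant polynomials on `L`. -/
def restrictedInvariants : Subalgebra ℂ (PolyFun H) := (adjointInvariants L).map (restrict H)

theorem sum_root_pow_mem {n : ℕ} (hn : n ≠ 0) :
    ∑ α : H.root, linearPart H (α : Weight ℂ H L).toLinear ^ n ∈ restrictedInvariants H := by
  obtain ⟨F, hF, hFy⟩ := exists_adjointInvariant_trace_pow (ad ℂ L : L →ₗ[ℂ] End ℂ L)
    (fun x y => LinearMap.ext fun z => lie_lie x y z) n
  refine ⟨F, hF, polyFun_ext fun h => ?_⟩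
  rw [polyFun_sum_apply]
  exact (hFy h).trans (trace_ad_pow h hn)

end AdTrace

/-! ### Highest weights are determined by invariant polynomials. -/

section HighestWeight

variable {L E : Type*} [LieRing L] [LieAlgebra ℂ L] [AddCommGroup E] [Module ℂ E]

/-- The smallest subspace containing `v` and stable under the operators `ρ x`, `x ∈ N`. -/
def stableSpan (ρ : L →ₗ[ℂ] End ℂ E) (N : Set L) (v : E) : Submodule ℂ E :=
  sInf {p | v ∈ p ∧ ∀ x ∈ N, ∀ w ∈ p, ρ x w ∈ p}

variable {ρ : L →ₗ[ℂ] End ℂ E} {N P : Set L} {v : E}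

theorem mem_stableSpan_self : v ∈ stableSpan ρ N v :=
  Submodule.mem_sInf.2 fun _ hp => hp.1

theorem apply_mem_stableSpan {x : L} (hx : x ∈ N) {w : E} (hw : w ∈ stableSpan ρ N v) :
    ρ x w ∈ stableSpan ρ N v :=
  Submodule.mem_sInf.2 fun p hp => hp.2 x hx w (Submodule.mem_sInf.1 hw p hp)

theorem stableSpan_le {p : Submodule ℂ E} (hv : v ∈ p) (hp : ∀ x ∈ N, ∀ w ∈ p, ρ x w ∈ p) :
    stableSpan ρ N v ≤ p :=
  sInf_le ⟨hv, hp⟩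

/-- If `N` and `P` span `L` and `P` stabilizes the line of `v`, then the span of `v` under `N` is
stable under `L`. -/
theorem stableSpan_stable (hρ : ∀ x y, ρ ⁅x, y⁆ = ρ x * ρ y - ρ y * ρ x)
    (hNP : Submodule.span ℂ (N ∪ P) = ⊤) (hP : ∀ x ∈ P, ∃ c : ℂ, ρ x v = c • v) (x : L) {w : E}
    (hw : w ∈ stableSpan ρ N v) : ρ x w ∈ stableSpan ρ N v := by
  -- T consists of the vectors of the span that L keeps in the span. It is stable under N because x
  -- y w = y x w + [x, y] w, and it contains v because N and P span L.
  let T : Submodule ℂ E :=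
    { carrier := {w | w ∈ stableSpan ρ N v ∧ ∀ x, ρ x w ∈ stableSpan ρ N v}
      add_mem' := fun h₁ h₂ => ⟨add_mem h₁.1 h₂.1, fun x => by
        rw [map_add]
        exact add_mem (h₁.2 x) (h₂.2 x)⟩
      zero_mem' := ⟨zero_mem _, fun x => by
        rw [map_zero]
        exact zero_mem _⟩
      smul_mem' := fun c w h => ⟨Submodule.smul_mem _ c h.1, fun x => by
        rw [map_smul]
        exact Submodule.smul_mem _ c (h.2 x)⟩ }
  have hT : stableSpan ρ N v ≤ T := by
    refine stableSpan_le ⟨mem_stableSpan_self, fun x => ?_⟩ fun y hy w hw =>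
      ⟨apply_mem_stableSpan hy hw.1, fun x => ?_⟩
    · have hx : x ∈ Submodule.span ℂ (N ∪ P) := hNP ▸ Submodule.mem_top
      induction hx using Submodule.span_induction with
      | mem x hx =>
        rcases hx with hx | hx
        · exact apply_mem_stableSpan hx mem_stableSpan_self
        · obtain ⟨c, hc⟩ := hP x hx
          rw [hc]
          exact Submodule.smul_mem _ c mem_stableSpan_self
      | zero => simp
      | add x y _ _ h₁ h₂ =>
        rw [map_add]
        exact add_mem h₁ h₂
      | smul c x _ h =>
        rw [map_smul]
        exact Submodule.smul_mem _ c h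
    · have : ρ x (ρ y w) = ρ y (ρ x w) + ρ ⁅x, y⁆ w := by
        rw [hρ]
        simp
      rw [this]
      exact add_mem (apply_mem_stableSpan hy (hw.2 x)) (hw.2 _)
  exact (hT hw).2 x

/-- If `ad k` acts on the elements of `N` with eigenvalues in `-ℕ` and `v` has weight `a` for `k`,
then all weights of `k` on the span of `v` under `N` are in `a - ℕ`. -/
theorem exists_nat_of_eigenvector (hρ : ∀ x y, ρ ⁅x, y⁆ = ρ x * ρ y - ρ y * ρ x) {k : L} {a : ℂ}
    (hk : ∀ x ∈ N, ∃ m : ℕ, ⁅k, x⁆ = -(m : ℂ) • x) (hv : ρ k v = a • v) {w : E}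
    (hw : w ∈ stableSpan ρ N v) (hw0 : w ≠ 0) {c : ℂ} (hc : ρ k w = c • w) :
    ∃ m : ℕ, c = a - m := by
  have hle : stableSpan ρ N v ≤ ⨆ m : ℕ, (ρ k).eigenspace (a - m) := by
    refine stableSpan_le (Submodule.mem_iSup_of_mem 0 ?_) fun x hx w hw => ?_
    · simpa [End.mem_eigenspace_iff] using hv
    · suffices (⨆ m : ℕ, (ρ k).eigenspace (a - m)) ≤
          (⨆ m : ℕ, (ρ k).eigenspace (a - m)).comap (ρ x) from this hw
      refine iSup_le fun m y hy => ?_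
      obtain ⟨n, hn⟩ := hk x hx
      refine Submodule.mem_iSup_of_mem (m + n) ?_
      rw [End.mem_eigenspace_iff] at hy ⊢
      have : ρ k (ρ x y) = ρ x (ρ k y) + ρ ⁅k, x⁆ y := by
        rw [hρ]
        simp
      rw [this, hy, hn, map_smul, map_smul, LinearMap.smul_apply, ← add_smul]
      push_cast
      ring_nf
  by_contra hne
  push Not at hne
  have hdisj := (ρ k).eigenspaces_iSupIndep c
  refine hw0 (Submodule.disjoint_def.1 hdisj w (End.mem_eigenspace_iff.2 hc) ?_)
  refine (iSup_le fun m => ?_ : (⨆ m : ℕ, (ρ k).eigenspace (a - m)) ≤ _) (hle hw)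
  exact le_iSup₂_of_le (a - m) (hne m).symm le_rfl

/-- Two elements not separated by the invariant polynomials have the same highest weight in any
highest weight representation for which both are dominant. -/
theorem weight_eq_of_invariants_eq (hρ : ∀ x y, ρ ⁅x, y⁆ = ρ x * ρ y - ρ y * ρ x)
    (hNP : Submodule.span ℂ (N ∪ P) = ⊤) (hP : ∀ x ∈ P, ∃ c : ℂ, ρ x v = c • v) (hv0 : v ≠ 0)
    {p : Submodule ℂ E} [FiniteDimensional ℂ p] (hvp : v ∈ p) (hp : ∀ x, ∀ w ∈ p, ρ x w ∈ p)
    {k k' : L} {a a' : ℂ}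
    (hk : ∀ x ∈ N, ∃ m : ℕ, ⁅k, x⁆ = -(m : ℂ) • x) (hv : ρ k v = a • v)
    (hk' : ∀ x ∈ N, ∃ m : ℕ, ⁅k', x⁆ = -(m : ℂ) • x) (hv' : ρ k' v = a' • v)
    (hF : ∀ F ∈ adjointInvariants L, (F : L → ℂ) k = (F : L → ℂ) k') : a = a' := by
  set S := stableSpan ρ N v with hS
  have : FiniteDimensional ℂ S :=
    Submodule.finiteDimensional_of_le (stableSpan_le hvp fun x _ => hp x)
  let σ : L →ₗ[ℂ] End ℂ S :=
    { toFun := fun x => (ρ x).restrict fun _ hw => stableSpan_stable hρ hNP hP x hw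
      map_add' := fun x y => LinearMap.ext fun w => Subtype.ext (by simp)
      map_smul' := fun c x => LinearMap.ext fun w => Subtype.ext (by simp) }
  have hσ (x y : L) : σ ⁅x, y⁆ = σ x * σ y - σ y * σ x :=
    LinearMap.ext fun w => Subtype.ext (LinearMap.congr_fun (hρ x y) (w : E))
  have htr (n : ℕ) : LinearMap.trace ℂ S (σ k ^ n) = LinearMap.trace ℂ S (σ k' ^ n) := by
    obtain ⟨F, hFi, hFy⟩ := exists_adjointInvariant_trace_pow σ hσ n
    rw [← hFy, ← hFy, hF F hFi]
  have hev {x : L} {c : ℂ} (hx : ρ x v = c • v) : (σ x).HasEigenvalue c := by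
    refine End.hasEigenvalue_of_hasEigenvector (x := ⟨v, mem_stableSpan_self⟩)
      (End.hasEigenvector_iff.2 ⟨End.mem_eigenspace_iff.2 (Subtype.ext hx), ?_⟩)
    exact fun h => hv0 (congrArg Subtype.val h)
  have hbound {x : L} {b : ℂ} (hx : ∀ y ∈ N, ∃ m : ℕ, ⁅x, y⁆ = -(m : ℂ) • y)
      (hxv : ρ x v = b • v) {c : ℂ} (hc : (σ x).HasEigenvalue c) : ∃ m : ℕ, c = b - m := by
    obtain ⟨w, hw⟩ := hc.exists_hasEigenvector
    refine exists_nat_of_eigenvector hρ hx hxv w.2 (fun h => hw.2 (Subtype.ext h)) ?_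
    exact congrArg Subtype.val hw.apply_eq_smul
  -- The equal traces make a an eigenvalue of k' and a' one of k. Hence a = a' - m and a' = a - n,
  -- so m + n = 0.
  obtain ⟨m, hm⟩ := hbound hk' hv' (hasEigenvalue_of_trace_pow_eq htr (hev hv))
  obtain ⟨n, hn⟩ := hbound hk hv (hasEigenvalue_of_trace_pow_eq (fun n => (htr n).symm) (hev hv'))
  have hmn : ((m + n : ℕ) : ℂ) = 0 := by
    push_cast
    linear_combination hm + hn
  have : m = 0 := by
    have := Nat.cast_eq_zero.1 hmn
    omega
  rw [hm, this, Nat.cast_zero, sub_zero]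

end HighestWeight

/-! ### Exterior powers realized as determinants on L ^ ι. -/

section Determinant

open Matrix in
theorem derivation_det {B ι : Type*} [CommRing B] [Algebra ℂ B] [Fintype ι] [DecidableEq ι]
    (D : Derivation ℂ B B) (M : Matrix ι ι B) :
    D M.det = ∑ i, (M.updateRow i fun j => D (M i j)).det := by
  have hprod (s : Finset ι) (f : ι → B) :
      D (∏ i ∈ s, f i) = ∑ i ∈ s, ∏ k ∈ s, Function.update f i (D (f i)) k := by
    induction s using Finset.induction_on with
    | empty => simp
    | insert a s ha ih =>
      rw [Finset.prod_insert ha, D.leibniz, ih, Finset.sum_insert ha, Finset.prod_insert ha,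
        Function.update_self, smul_eq_mul, smul_eq_mul, add_comm, mul_comm (∏ i ∈ s, f i)]
      congr 1
      · congr 1
        refine Finset.prod_congr rfl fun k hk => ?_
        rw [Function.update_of_ne (fun h : k = a => ha (h ▸ hk))]
      · rw [Finset.mul_sum]
        refine Finset.sum_congr rfl fun i hi => ?_
        rw [Finset.prod_insert ha, Function.update_of_ne (fun h : a = i => ha (h ▸ hi))]
  have hdet (M : Matrix ι ι B) :
      M.det = ∑ σ : Equiv.Perm ι, ((Equiv.Perm.sign σ : ℤ)) • ∏ i, M i (σ i) := by
    rw [← det_transpose, det_apply]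
    rfl
  rw [hdet, map_sum]
  simp_rw [hdet]
  rw [Finset.sum_comm]
  refine Finset.sum_congr rfl fun σ _ => ?_
  rw [map_zsmul, hprod, Finset.smul_sum]
  refine Finset.sum_congr rfl fun i _ => ?_
  congr 1
  refine Finset.prod_congr rfl fun k _ => ?_
  by_cases h : k = i
  · subst h
    simp
  · rw [Function.update_of_ne h, updateRow_ne h]

/-- The order is reversed because functions pull back contravariantly. -/
theorem vectorField_commutator {V : Type*} [AddCommGroup V] [Module ℂ V] (A B : End ℂ V)
    (F : PolyFun V) : vectorField (B * A - A * B) F =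
      vectorField A (vectorField B F) - vectorField B (vectorField A F) := by
  have : vectorField (B * A - A * B) = ⁅vectorField A, vectorField B⁆ := derivation_ext fun l => by
    rw [Derivation.commutator_apply]
    simp only [vectorField_linear]
    rw [← map_sub]
    congr 1
    refine LinearMap.ext fun z => ?_
    simp
  rw [this, Derivation.commutator_apply]

variable {L ι : Type*} [LieRing L] [LieAlgebra ℂ L]

/-- The diagonal vector field `y ↦ (-[x, yᵢ])ᵢ` on `L ^ ι`. -/
def diagonalField (x : L) : End ℂ (ι → L) :=
  LinearMap.pi fun i => (-LieAlgebra.ad ℂ L x) ∘ₗ LinearMap.proj i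

theorem diagonalField_apply (x : L) (y : ι → L) : diagonalField x y = fun i => -⁅x, y i⁆ := rfl

variable (L ι) in
/-- The diagonal action of `L` on the polynomial functions on `L ^ ι`. -/
def diagonalAction : L →ₗ[ℂ] End ℂ (PolyFun (ι → L)) where
  toFun x := (vectorField (diagonalField x)).toLinearMap
  map_add' x y := by
    rw [← Derivation.coe_add_linearMap]
    congr 1
    refine derivation_ext fun l => ?_
    rw [Derivation.add_apply, vectorField_linear, vectorField_linear, vectorField_linear, ← map_add]
    congr 1
    refine LinearMap.ext fun z => ?_
    rw [LinearMap.add_apply, LinearMap.comp_apply, LinearMap.comp_apply, LinearMap.comp_apply,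
      ← map_add]
    refine congrArg l (funext fun i => ?_)
    simp only [diagonalField_apply, Pi.add_apply, add_lie]
    abel
  map_smul' c x := by
    rw [RingHom.id_apply, ← Derivation.coe_smul_linearMap]
    congr 1
    refine derivation_ext fun l => ?_
    rw [Derivation.smul_apply, vectorField_linear, vectorField_linear, ← map_smul]
    congr 1
    refine LinearMap.ext fun z => ?_
    rw [LinearMap.smul_apply, LinearMap.comp_apply, LinearMap.comp_apply, ← map_smul]
    refine congrArg l (funext fun i => ?_)
    simp only [diagonalField_apply, Pi.smul_apply, smul_lie, smul_neg]

theorem diagonalAction_apply (x : L) (F : PolyFun (ι → L)) :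
    diagonalAction L ι x F = vectorField (diagonalField x) F := rfl

theorem diagonalAction_lie (x y : L) : diagonalAction L ι ⁅x, y⁆ =
    diagonalAction L ι x * diagonalAction L ι y - diagonalAction L ι y * diagonalAction L ι x := by
  have h : (diagonalField ⁅x, y⁆ : End ℂ (ι → L)) =
      diagonalField y * diagonalField x - diagonalField x * diagonalField y :=
    LinearMap.ext fun z => funext fun i => by
      simp only [LinearMap.sub_apply, End.mul_apply, Pi.sub_apply, diagonalField_apply, lie_lie,
        lie_neg]
      abel
  refine LinearMap.ext fun F => ?_
  rw [diagonalAction_apply, h, vectorField_commutator]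
  rfl

theorem vectorField_mem_homogeneous {V : Type*} [AddCommGroup V] [Module ℂ V] (A : End ℂ V) {n : ℕ}
    {F : PolyFun V} (hF : F ∈ homogeneous V n) : vectorField A F ∈ homogeneous V n := by
  induction n generalizing F with
  | zero =>
    rw [homogeneous, pow_zero, Submodule.mem_one] at hF
    obtain ⟨r, rfl⟩ := hF
    rw [Derivation.map_algebraMap]
    exact zero_mem _
  | succ n ih =>
    rw [homogeneous, pow_succ] at hF ⊢
    induction hF using Submodule.mul_induction_on' with
    | mem_mul_mem G hG l hl =>
      obtain ⟨l, rfl⟩ := hl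
      rw [Derivation.leibniz, vectorField_linear, smul_eq_mul, smul_eq_mul, mul_comm (linearPart V l)]
      exact add_mem (Submodule.mul_mem_mul hG ⟨_, rfl⟩) (Submodule.mul_mem_mul (ih hG) ⟨_, rfl⟩)
    | add F _ G _ h₁ h₂ =>
      rw [map_add]
      exact add_mem h₁ h₂

/-- The linear function `y ↦ κ(z, yⱼ)` on `L ^ ι`, where `κ` is the Killing form. -/
def killingCoord (z : L) (j : ι) : PolyFun (ι → L) :=
  linearPart (ι → L) (killingForm ℂ L z ∘ₗ LinearMap.proj j)

theorem vectorField_killingCoord (x z : L) (j : ι) :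
    vectorField (diagonalField x) (killingCoord z j) = killingCoord ⁅x, z⁆ j := by
  rw [killingCoord, vectorField_linear, killingCoord]
  congr 1
  refine LinearMap.ext fun y => ?_
  simp only [LinearMap.comp_apply, diagonalField_apply, LinearMap.proj_apply, map_neg]
  rw [LieModule.traceForm_apply_lie_apply']

/-- The matrix of functions `κ(eᵢ, yⱼ)` on `L ^ ι`. -/
def killingMatrix (e : ι → L) : Matrix ι ι (PolyFun (ι → L)) :=
  Matrix.of fun i j => killingCoord (e i) j

theorem killingMatrix_update [DecidableEq ι] (e : ι → L) (i : ι) (z : L) :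
    killingMatrix (Function.update e i z) = (killingMatrix e).updateRow i (killingCoord z) := by
  refine Matrix.ext fun k j => ?_
  by_cases h : k = i
  · subst h
    rw [Matrix.updateRow_self, killingMatrix, Matrix.of_apply, Function.update_self]
  · rw [Matrix.updateRow_ne h, killingMatrix, Matrix.of_apply, Function.update_of_ne h]
    rfl

variable [Fintype ι] [DecidableEq ι]

/-- The function `y ↦ det (κ(eᵢ, yⱼ))` on `L ^ ι`. -/
def killingDet (e : ι → L) : PolyFun (ι → L) :=
  (killingMatrix e).det

/-- The determinant plays the part of the wedge of the eᵢ, transported to functions by the Killing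
form; x acts on one factor at a time by the invariance of that form. -/
theorem diagonalAction_killingDet (x : L) (e : ι → L) :
    diagonalAction L ι x (killingDet e) = ∑ i, killingDet (Function.update e i ⁅x, e i⁆) := by
  rw [diagonalAction_apply, killingDet, derivation_det]
  refine Finset.sum_congr rfl fun i _ => ?_
  rw [killingDet, killingMatrix_update]
  congr 2
  exact funext fun j => vectorField_killingCoord x (e i) j

theorem killingDet_update_smul (e : ι → L) (i : ι) (c : ℂ) (z : L) :
    killingDet (Function.update e i (c • z)) = c • killingDet (Function.update e i z) := by
  have hz : (killingCoord (c • z) : ι → PolyFun (ι → L)) =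
      algebraMap ℂ (PolyFun (ι → L)) c • killingCoord z := by
    funext j
    rw [killingCoord, map_smul, LinearMap.smul_comp, map_smul, Pi.smul_apply, algebraMap_smul]
    rfl
  rw [killingDet, killingDet, killingMatrix_update, killingMatrix_update, hz,
    Matrix.det_updateRow_smul, Algebra.smul_def]

theorem killingDet_eq_zero {e : ι → L} {i j : ι} (hij : i ≠ j) (h : e i = e j) :
    killingDet e = 0 :=
  Matrix.det_zero_of_row_eq hij (congrArg killingCoord h)

theorem scaling_prod {V κ : Type*} [AddCommGroup V] [Module ℂ V] (s : Finset κ) (l : κ → Dual ℂ V) :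
    scaling (∏ i ∈ s, linearPart V (l i)) = (2 ^ s.card : ℂ) • ∏ i ∈ s, linearPart V (l i) := by
  have h (l : Dual ℂ V) : scaling (linearPart V l) = (2 : ℂ) • linearPart V l := by
    simpa using scaling_of_mem_homogeneous (linearPart_mem_homogeneous l)
  rw [map_prod, Finset.prod_congr rfl fun i _ => h (l i), Finset.prod_smul, Finset.prod_const]

/-- This places the wedge in a finite-dimensional space stable under L, so that traces make sense.
-/
theorem killingDet_mem_homogeneous (e : ι → L) :
    killingDet e ∈ homogeneous (ι → L) (Fintype.card ι) := by
  rw [killingDet, Matrix.det_apply]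
  refine sum_mem fun σ _ => ?_
  rw [Units.smul_def]
  refine zsmul_mem ?_ _
  rw [mem_homogeneous_iff]
  exact scaling_prod Finset.univ fun i => killingForm ℂ L (e (σ i)) ∘ₗ LinearMap.proj i

theorem killingDet_apply (e y : ι → L) :
    (killingDet e : (ι → L) → ℂ) y = (Matrix.of fun i j => killingForm ℂ L (e i) (y j)).det := by
  rw [← evalAt_apply, killingDet, AlgHom.map_det]
  rfl

end Determinant

/-! ### Comparing two integral points through highest weights. -/

section Dominance

open LieAlgebra LieAlgebra.IsKilling LieModule

variable {L : Type*} [LieRing L] [LieAlgebra ℂ L] [FiniteDimensional ℂ L]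
  [LieAlgebra.IsSemisimple ℂ L] {H : LieSubalgebra ℂ L} [H.IsCartanSubalgebra]

theorem eq_smul_of_mem_rootSpace {α : Weight ℂ H L} (hα : α.IsNonZero) {x e : L}
    (hx : x ∈ rootSpace H α) (he : e ∈ rootSpace H α) (he0 : e ≠ 0) : ∃ c : ℂ, x = c • e := by
  obtain ⟨c, hc⟩ := (finrank_eq_one_iff_of_nonzero' (⟨e, he⟩ : rootSpace H α)
    (fun h => he0 (congrArg Subtype.val h))).1 (finrank_rootSpace_eq_one α hα) ⟨x, hx⟩
  exact ⟨c, (congrArg Subtype.val hc).symm⟩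

section

variable {ι : Type*} [Fintype ι] [DecidableEq ι] {a : ι → Weight ℂ H L} {e : ι → L}

theorem diagonalAction_cartan_killingDet (he : ∀ i, e i ∈ rootSpace H (a i)) (k : H) :
    diagonalAction L ι k (killingDet e) = (∑ i, a i k) • killingDet e := by
  rw [diagonalAction_killingDet, Finset.sum_smul]
  refine Finset.sum_congr rfl fun i _ => ?_
  rw [lie_rootVector (he i), killingDet_update_smul, Function.update_eq_self]

/-- In each summand [x, eᵢ] is zero or a multiple of some eⱼ. Here j ≠ i because α ≠ 0, so two rows
coincide. -/
theorem diagonalAction_root_killingDet (he : ∀ i, e i ∈ rootSpace H (a i)) (he0 : ∀ i, e i ≠ 0)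
    {α : Weight ℂ H L} (hα : α.IsNonZero)
    (hadd : ∀ (i : ι) (γ : Weight ℂ H L), (γ : H → ℂ) = α + a i → γ.IsNonZero ∧ ∃ j, a j = γ)
    {x : L} (hx : x ∈ rootSpace H α) : diagonalAction L ι x (killingDet e) = 0 := by
  rw [diagonalAction_killingDet]
  refine Finset.sum_eq_zero fun i _ => ?_
  have hmem : ⁅x, e i⁆ ∈ rootSpace H (α + a i : H → ℂ) :=
    lie_mem_genWeightSpace_of_mem_genWeightSpace hx (he i)
  by_cases h0 : ⁅x, e i⁆ = 0
  · rw [h0, ← zero_smul ℂ (0 : L), killingDet_update_smul, zero_smul]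
  · let γ : Weight ℂ H L := ⟨α + a i, fun hbot => h0 (by simpa [hbot] using hmem)⟩
    obtain ⟨hγ, j, hj⟩ := hadd i γ rfl
    have hji : j ≠ i := by
      rintro rfl
      refine hα ?_
      have h1 : (a j : H → ℂ) = α + a j := congrArg DFunLike.coe hj
      simpa using h1
    obtain ⟨c, hc⟩ := eq_smul_of_mem_rootSpace hγ hmem (hj ▸ he j) (he0 j)
    rw [hc, killingDet_update_smul, killingDet_eq_zero hji, smul_zero]
    rw [Function.update_of_ne hji, Function.update_self]

end

/-- Let `h` and `h'` be points at which the roots take integral values, such that `h'` is in the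
closure of a Weyl chamber containing `h` in its closure. If the invariant polynomials do not
separate `h` and `h'`, then neither do the sums of the roots that are large at `h`. -/
theorem sum_roots_gt_eq {h h' : H} {z z' : Weight ℂ H L → ℤ} (hz : ∀ α : Weight ℂ H L, α h = z α)
    (hz' : ∀ α : Weight ℂ H L, α h' = z' α) (hdom : ∀ α, 0 < z α → 0 ≤ z' α)
    (hF : ∀ F ∈ adjointInvariants L, (F : L → ℂ) h = (F : L → ℂ) h') (t : ℕ) :
    ∑ α with t < z α, z α = ∑ α with t < z α, z' α := by
  classical
  let ι := {α : Weight ℂ H L // t < z α}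
  have hnz (α : ι) : (α : Weight ℂ H L).IsNonZero := by
    intro h0
    have h1 : ((z α : ℤ) : ℂ) = 0 := (hz α).symm.trans (congrFun h0 h)
    have h2 : z α = 0 := by exact_mod_cast h1
    have h3 := α.2
    omega
  have hneg (α : Weight ℂ H L) : z (-α) = -z α ∧ z' (-α) = -z' α := by
    constructor
    · have : ((z (-α) : ℤ) : ℂ) = -(z α : ℤ) := by rw [← hz, ← hz]; rfl
      exact_mod_cast this
    · have : ((z' (-α) : ℤ) : ℂ) = -(z' α : ℤ) := by rw [← hz', ← hz']; rfl
      exact_mod_cast this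
  choose k e f ht he hf using fun α : ι => exists_isSl2Triple_of_weight_isNonZero (hnz α)
  -- N lowers the weights of h; P contains H and the other root spaces, including those of roots
  -- vanishing at h. The set of roots with value above t is closed under adding roots from P, so P
  -- stabilizes the line of the wedge.
  let N : Set L := {x | ∃ α : Weight ℂ H L, z α < 0 ∧ x ∈ rootSpace H α}
  let P : Set L := {x | x ∈ H} ∪ {x | ∃ α : Weight ℂ H L, α.IsNonZero ∧ 0 ≤ z α ∧ x ∈ rootSpace H α}
  have hNP : Submodule.span ℂ (N ∪ P) = ⊤ := by
    refine eq_top_of_rootSpace_le (H := H)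
      (fun x => Submodule.subset_span (Or.inr (Or.inl x.2))) fun α hα x hx => ?_
    rcases lt_or_ge (z α) 0 with h0 | h0
    · exact Submodule.subset_span (Or.inl ⟨α, h0, hx⟩)
    · exact Submodule.subset_span (Or.inr (Or.inr ⟨α, hα, h0, hx⟩))
  have hH (x : H) := diagonalAction_cartan_killingDet (a := Subtype.val) he x
  have hP : ∀ x ∈ P, ∃ c : ℂ, diagonalAction L ι x (killingDet e) = c • killingDet e := by
    rintro x (hx | ⟨α, hα, hα0, hx⟩)
    · exact ⟨_, hH ⟨x, hx⟩⟩
    · refine ⟨0, ?_⟩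
      rw [zero_smul]
      refine diagonalAction_root_killingDet (a := Subtype.val) he (fun i => (ht i).e_ne_zero) hα
        (fun i γ hγ => ?_) hx
      have h1 : z γ = z α + z i := by
        have : ((z γ : ℤ) : ℂ) = z α + z i := by rw [← hz, ← hz, ← hz, hγ]; rfl
        exact_mod_cast this
      have h2 : t < z γ := by
        have := i.2
        omega
      exact ⟨hnz ⟨γ, h2⟩, ⟨γ, h2⟩, rfl⟩
  have hv0 : killingDet e ≠ 0 := by
    intro h0
    have h1 := killingDet_apply e f
    -- At the opposite root vectors f the Killing matrix is diagonal, since distinct roots i and j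
    -- have i - j ≠ 0. A zero diagonal entry would force the corresponding [e, f] to vanish.
    have hdiag : (Matrix.of fun i j => killingForm ℂ L (e i) (f j)) =
        Matrix.diagonal fun i => killingForm ℂ L (e i) (f i) := by
      refine Matrix.ext fun i j => ?_
      by_cases hij : i = j
      · subst hij
        simp
      · rw [Matrix.diagonal_apply_ne _ hij, Matrix.of_apply]
        refine killingForm_apply_eq_zero_of_mem_rootSpace_of_add_ne_zero ℂ L H (he i) (hf j) ?_
        intro h2
        refine hij (Subtype.ext (DFunLike.coe_injective ?_))
        simpa [← sub_eq_add_neg, sub_eq_zero] using h2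
    rw [h0, hdiag, Matrix.det_diagonal] at h1
    obtain ⟨i, -, hi⟩ := Finset.prod_eq_zero_iff.1 h1.symm
    refine (ht i).h_ne_zero ?_
    rw [← (ht i).lie_e_f, lie_eq_killingForm_smul_of_mem_rootSpace_of_mem_rootSpace_neg (he i) (hf i),
      hi, zero_smul]
  have hNz {y : H} {w : Weight ℂ H L → ℤ} (hy : ∀ α : Weight ℂ H L, α y = w α)
      (hw : ∀ α, z α < 0 → w α ≤ 0) : ∀ x ∈ N, ∃ m : ℕ, ⁅(y : L), x⁆ = -(m : ℂ) • x := by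
    rintro x ⟨α, hα, hx⟩
    refine ⟨(-w α).toNat, ?_⟩
    have h1 : (((-w α).toNat : ℤ) : ℂ) = ((-w α : ℤ) : ℂ) := by
      rw [Int.toNat_of_nonneg]
      have := hw α hα
      omega
    rw [Int.cast_natCast] at h1
    rw [lie_rootVector hx, hy, h1, Int.cast_neg, neg_neg]
  have := finiteDimensional_homogeneous (V := ι → L) (Fintype.card ι)
  have key := weight_eq_of_invariants_eq (ρ := diagonalAction L ι) diagonalAction_lie hNP hP hv0
    (p := homogeneous (ι → L) (Fintype.card ι)) (killingDet_mem_homogeneous e)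
    (fun x w hw => vectorField_mem_homogeneous _ hw) (hNz hz fun α hα => hα.le) (hH h)
    (hNz hz' fun α hα => by
      have := hdom (-α)
      rw [(hneg α).1, (hneg α).2] at this
      have := this (by omega)
      omega) (hH h') hF
  simp only [hz, hz'] at key
  rw [Finset.sum_subtype (p := fun α => t < z α) _ (by simp),
    Finset.sum_subtype (p := fun α => t < z α) _ (by simp)]
  exact_mod_cast key

/-- Under the hypotheses of `sum_roots_gt_eq`, the Killing form of `h` with `h'` is that of `h`
with itself. -/
theorem sum_root_mul_eq {h h' : H} {z z' : Weight ℂ H L → ℤ} (hz : ∀ α : Weight ℂ H L, α h = z α)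
    (hz' : ∀ α : Weight ℂ H L, α h' = z' α) (hdom : ∀ α, 0 < z α → 0 ≤ z' α)
    (hF : ∀ F ∈ adjointInvariants L, (F : L → ℂ) h = (F : L → ℂ) h') :
    ∑ α, z α * z' α = ∑ α, z α * z α := by
  classical
  have hneg (α : Weight ℂ H L) : z (-α) = -z α ∧ z' (-α) = -z' α := by
    constructor
    · have : ((z (-α) : ℤ) : ℂ) = -(z α : ℤ) := by rw [← hz, ← hz]; rfl
      exact_mod_cast this
    · have : ((z' (-α) : ℤ) : ℂ) = -(z' α : ℤ) := by rw [← hz', ← hz']; rfl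
      exact_mod_cast this
  let n : ℕ := ∑ α, (z α).toNat
  have hn (α : Weight ℂ H L) : (z α).toNat ≤ n :=
    Finset.single_le_sum (f := fun α => (z α).toNat) (fun _ _ => Nat.zero_le _) (Finset.mem_univ α)
  -- A root α is counted once for every t with 0 ≤ t < z α; n bounds all z α. Summing the equalities
  -- of `sum_roots_gt_eq` over t thus weights each root by the positive part of z.
  have hcount (w : Weight ℂ H L → ℤ) :
      ∑ t ∈ Finset.range n, ∑ α with ((t : ℕ) : ℤ) < z α, w α = ∑ α, ((z α).toNat : ℤ) * w α := by
    simp_rw [Finset.sum_filter]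
    rw [Finset.sum_comm]
    refine Finset.sum_congr rfl fun α _ => ?_
    rw [← Finset.sum_filter, Finset.sum_const, nsmul_eq_mul]
    congr 2
    have : (Finset.range n).filter (fun t : ℕ => (t : ℤ) < z α) = Finset.range (z α).toNat := by
      ext t
      have := hn α
      simp only [Finset.mem_filter, Finset.mem_range]
      omega
    rw [this, Finset.card_range]
  have hpos : ∑ α, ((z α).toNat : ℤ) * (z α - z' α) = 0 := by
    simp_rw [mul_sub]
    rw [Finset.sum_sub_distrib, ← hcount, ← hcount, sub_eq_zero]
    exact Finset.sum_congr rfl fun t _ => sum_roots_gt_eq hz hz' hdom hF t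
  -- The symmetry α ↦ -α turns the positive parts into the negative parts.
  have hpos' : ∑ α, ((-z α).toNat : ℤ) * (z' α - z α) = 0 := by
    rw [← hpos]
    refine Fintype.sum_equiv (Equiv.neg (Weight ℂ H L)) _ _ fun α => ?_
    rw [Equiv.neg_apply, (hneg α).1, (hneg α).2]
    ring
  have h3 : ∑ α, (z α * z α - z α * z' α) = 0 := by
    have h4 := congrArg₂ (· + ·) hpos hpos'
    simp only [← Finset.sum_add_distrib, add_zero] at h4
    rw [← h4]
    refine Finset.sum_congr rfl fun α _ => ?_
    have h5 : z α = (z α).toNat - ((-z α).toNat : ℤ) := by omega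
    linear_combination (z α - z' α) * h5
  rw [Finset.sum_sub_distrib, sub_eq_zero] at h3
  exact h3.symm

end Dominance

/-! ### Linear maps permuting roots and preserving restricted invariants fix Weyl invariants. -/

section Orbit

open LieAlgebra LieAlgebra.IsKilling LieModule

variable {L : Type*} [LieRing L] [LieAlgebra ℂ L] [FiniteDimensional ℂ L]

section

variable {H : LieSubalgebra ℂ L} [H.IsCartanSubalgebra]

theorem weight_sub_smul (α : Weight ℂ H L) (x y : H) (c : ℂ) : α (x - c • y) = α x - c * α y := by
  rw [← Weight.toLinear_apply, map_sub, map_smul]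
  rfl

theorem sum_root_eq_sum_weight {M : Type*} [AddCommMonoid M] (g : Weight ℂ H L → M)
    (hg : ∀ α, α.IsZero → g α = 0) : ∑ α : H.root, g α = ∑ α, g α := by
  rw [Finset.sum_coe_sort H.root g]
  refine Finset.sum_subset (Finset.subset_univ _) fun α _ hα => hg α ?_
  simpa using hα

end

variable [LieAlgebra.IsSemisimple ℂ L] {H : LieSubalgebra ℂ L} [H.IsCartanSubalgebra]

theorem eq_of_forall_weight_eq {x y : H} (h : ∀ α : Weight ℂ H L, α x = α y) : x = y := by
  have hxy : x - y ∈ ⨅ α : Weight ℂ H L, α.ker := by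
    refine Submodule.mem_iInf _ |>.2 fun α => ?_
    have := weight_sub_smul α x y 1
    rw [one_smul, one_mul, h, sub_self] at this
    exact this
  rw [iInf_ker_weight_eq_bot, Submodule.mem_bot, sub_eq_zero] at hxy
  exact hxy

theorem traceForm_eq_sum (x y : H) :
    traceForm ℂ H L x y = ∑ α : Weight ℂ H L, α x * α y := by
  rw [← restrict_killingForm, restrict_killingForm_eq_sum,
    ← sum_root_eq_sum_weight (fun α => α x * α y), ← Finset.sum_coe_sort]
  · simp [LinearMap.sum_apply]
  · intro α hα
    rw [congrFun hα x]
    simp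

/-- The pairing of a point with a coroot under the Killing form
is a positive multiple of the value of the root. -/
theorem exists_pos_traceForm_coroot {γ : Weight ℂ H L} (hγ : γ.IsNonZero) :
    ∃ c : ℝ, 0 < c ∧ ∀ x : H, ∑ α : Weight ℂ H L, α x * α (coroot γ) = c * γ x := by
  set c : ℂ := 2 * (γ ((cartanEquivDual H).symm γ))⁻¹ with hc
  have h1 (x : H) : ∑ α : Weight ℂ H L, α x * α (coroot γ) = c * γ x := by
    rw [← traceForm_eq_sum, traceForm_comm, traceForm_coroot, hc, nsmul_eq_mul, smul_eq_mul, mul_assoc]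
    rfl
  -- At x = coroot γ the identity reads ∑ n α² = 2 c with integers n α, and n γ = 2; so c is real
  -- and positive.
  have h2 := h1 (coroot γ)
  rw [root_apply_coroot hγ] at h2
  have hint (α : Weight ℂ H L) : ∃ n : ℤ, α (coroot γ) = n := ⟨_, apply_coroot_eq_cast γ α⟩
  choose n hn using hint
  simp only [hn] at h2
  have hpos : 0 < ∑ α, n α * n α := by
    refine Finset.sum_pos' (fun α _ => mul_self_nonneg _) ⟨γ, Finset.mem_univ _, ?_⟩
    have : ((n γ : ℤ) : ℂ) = 2 := by rw [← hn, root_apply_coroot hγ]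
    have : n γ = 2 := by exact_mod_cast this
    rw [this]
    norm_num
  have hc' : c = (((∑ α, n α * n α : ℤ) : ℝ) / 2 : ℝ) := by
    push_cast
    linear_combination -h2 / 2
  refine ⟨((∑ α, n α * n α : ℤ) : ℝ) / 2, by positivity, fun x => ?_⟩
  rw [h1, hc']

theorem exists_int_of_mem_closure {h : H}
    (hh : h ∈ AddSubgroup.closure (Set.range fun α : H.root => coroot (α : Weight ℂ H L)))
    (β : Weight ℂ H L) : ∃ n : ℤ, β h = n := by
  have hadd (x y : H) : β (x + y) = β x + β y := β.toLinear.map_add x y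
  induction hh using AddSubgroup.closure_induction with
  | mem x hx =>
    obtain ⟨α, rfl⟩ := hx
    exact ⟨_, apply_coroot_eq_cast (α : Weight ℂ H L) β⟩
  | zero => exact ⟨0, by simp⟩
  | add x y _ _ h₁ h₂ =>
    obtain ⟨m, hm⟩ := h₁
    obtain ⟨n, hn⟩ := h₂
    exact ⟨m + n, by rw [hadd, hm, hn]; push_cast; rfl⟩
  | neg x _ h =>
    obtain ⟨m, hm⟩ := h
    exact ⟨-m, by rw [Int.cast_neg, ← hm]; exact β.toLinear.map_neg x⟩

/-- A linear map `s` that maps roots to roots and preserves the restrictions of the invariant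
polynomials acts on integral points through the Weyl group, up to `W`-invariant functions. -/
theorem weylInvariant_apply_of_integral {s : H →ₗ[ℂ] H}
    (hs : ∀ α : Weight ℂ H L, ∃ β : Weight ℂ H L, ∀ x, α (s x) = β x)
    (hR : ∀ F ∈ adjointInvariants L, ∀ x : H, (F : L → ℂ) (s x) = (F : L → ℂ) x)
    {f : PolyFun H} (hf : f ∈ weylInvariants H) {h : H} {z : Weight ℂ H L → ℤ}
    (hz : ∀ α : Weight ℂ H L, α h = z α) : (f : H → ℂ) (s h) = (f : H → ℂ) h := by
  -- O is stable under reflections. It is finite: points are determined by their root values, and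
  -- these come from a finite list.
  let O : Set H := {x | (∀ α : Weight ℂ H L, ∃ β : Weight ℂ H L, α x = β h) ∧
    ∀ g ∈ weylInvariants H, (g : H → ℂ) x = (g : H → ℂ) (s h)}
  have hO : s h ∈ O := ⟨fun α => (hs α).imp fun β hβ => hβ h, fun _ _ => rfl⟩
  have hfin : O.Finite := by
    choose b hb using fun x : O => x.2.1
    have hinj : Function.Injective b := fun x y hxy =>
      Subtype.ext (eq_of_forall_weight_eq fun α => by rw [hb, hb, hxy])
    have := Finite.of_injective b hinj
    exact Set.toFinite O
  obtain ⟨x, hx, hmax⟩ := Set.exists_max_image O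
    (fun y => (∑ α : Weight ℂ H L, α h * α y).re) hfin ⟨_, hO⟩
  choose b hb using hx.1
  have hz' (α : Weight ℂ H L) : α x = z (b α) := by rw [hb, hz]
  have hFx (F : PolyFun L) (hF : F ∈ adjointInvariants L) : (F : L → ℂ) h = (F : L → ℂ) x := by
    rw [← hR F hF h]
    exact (hx.2 _ (restrict_mem_weylInvariants hF)).symm
  -- If γ were negative at x and positive at h, reflecting x in γ would increase its Killing product
  -- with h.
  have hdom (γ : Weight ℂ H L) (hγ : 0 < z γ) : 0 ≤ z (b γ) := by
    have hnz : γ.IsNonZero := fun h0 => by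
      have : ((z γ : ℤ) : ℂ) = 0 := (hz γ).symm.trans (congrFun h0 h)
      exact hγ.ne' (by exact_mod_cast this)
    have hy : x - γ x • coroot γ ∈ O := by
      refine ⟨fun α => ⟨b (reflectRoot γ α), ?_⟩, fun g hg => ?_⟩
      · rw [← hb, weight_sub_smul, mul_comm]
        rfl
      · rw [mem_weylInvariants_iff.1 hg γ hnz, hx.2 g hg]
    obtain ⟨c, hc, hcγ⟩ := exists_pos_traceForm_coroot hnz
    have h1 := hmax _ hy
    have h2 : ∑ α : Weight ℂ H L, α h * α (x - γ x • coroot γ) =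
        ∑ α : Weight ℂ H L, α h * α x - ((z (b γ) * (c * z γ) : ℝ) : ℂ) := by
      push_cast
      rw [← hz', ← hz, ← hcγ, Finset.mul_sum, ← Finset.sum_sub_distrib]
      refine Finset.sum_congr rfl fun α _ => ?_
      rw [weight_sub_smul]
      ring
    simp only [h2, Complex.sub_re, Complex.ofReal_re] at h1
    have h3 : 0 ≤ (z (b γ) : ℝ) * (c * z γ) := by linarith
    have h4 : 0 < c * (z γ : ℝ) := mul_pos hc (by exact_mod_cast hγ)
    exact_mod_cast nonneg_of_mul_nonneg_left h3 h4
  have hmul := sum_root_mul_eq hz hz' hdom hFx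
  -- The quadratic invariant ∑ α² is a restriction, so it agrees at h and x.
  have hsq : ∑ α, z (b α) * z (b α) = ∑ α, z α * z α := by
    obtain ⟨F, hF, hFr⟩ := sum_root_pow_mem (H := H) two_ne_zero
    have hval (y : H) : (F : L → ℂ) y = ∑ α : Weight ℂ H L, α y * α y := by
      have h1 := congrArg (fun g : PolyFun H => (g : H → ℂ) y) hFr
      rw [← sum_root_eq_sum_weight (fun α => α y * α y)]
      · refine h1.trans ?_
        simp only [polyFun_sum_apply, sq]
        rfl
      · intro α hα
        rw [congrFun hα y]
        simp
    have h1 := hFx F hF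
    rw [hval, hval] at h1
    simp only [hz, hz'] at h1
    exact_mod_cast h1.symm
  have hzero : ∑ α, (z α - z (b α)) ^ 2 = 0 := by
    have : ∑ α, (z α - z (b α)) ^ 2 =
        ∑ α, z α * z α - 2 * ∑ α, z α * z (b α) + ∑ α, z (b α) * z (b α) := by
      rw [Finset.mul_sum, ← Finset.sum_sub_distrib, ← Finset.sum_add_distrib]
      exact Finset.sum_congr rfl fun α _ => by ring
    rw [this, hmul, hsq]
    ring
  have hxh : x = h := eq_of_forall_weight_eq fun α => by
    have := (Finset.sum_eq_zero_iff_of_nonneg fun α _ => sq_nonneg _).1 hzero α (Finset.mem_univ α)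
    rw [hz', hz, sub_eq_zero.1 (pow_eq_zero_iff two_ne_zero |>.1 this)]
  rw [← hx.2 f hf, hxh]

/-- A linear map that maps roots to roots and preserves the restrictions of the invariant
polynomials on `L` preserves the Weyl group invariants. -/
theorem pullback_weylInvariant {s : H →ₗ[ℂ] H}
    (hs : ∀ α : Weight ℂ H L, ∃ β : Weight ℂ H L, ∀ x, α (s x) = β x)
    (hR : ∀ F ∈ adjointInvariants L, ∀ x : H, (F : L → ℂ) (s x) = (F : L → ℂ) x)
    {f : PolyFun H} (hf : f ∈ weylInvariants H) : pullback s f = f := by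
  rw [← sub_eq_zero]
  -- The coroots span H and roots are integral on their lattice, so the identity need only be
  -- checked at integral points.
  refine eq_zero_of_forall_mem_addSubgroup (S := Set.range fun α : H.root =>
    coroot (α : Weight ℂ H L))
    (RootPairing.IsRootSystem.span_coroot_eq_top (P := rootSystem H)) fun h hh => ?_
  choose z hz using exists_int_of_mem_closure hh
  exact sub_eq_zero.2 (weylInvariant_apply_of_integral hs hR hf hz)

end Orbit

/-! ### Galois descent and integral closure. -/

section Galois

open Polynomial

/-- Let `A` be a domain generated over `ℂ` by elements `aᵢ`, and `R` a subalgebra containing the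
coefficients of `∏ (X - aᵢ)`. An element of `A` fixed by the `R`-endomorphisms of `A` permuting
the `aᵢ` is a quotient of elements of `R`. -/
theorem exists_mul_mem_of_forall_fixed {A : Type*} (Q : Type*) {ι : Type*} [CommRing A] [IsDomain A]
    [Algebra ℂ A] [Field Q] [Algebra A Q] [IsFractionRing A Q] [Algebra ℂ Q]
    [IsScalarTower ℂ A Q] [Fintype ι] {R : Subalgebra ℂ A} {a : ι → A} (ha : Algebra.adjoin ℂ (Set.range a) = ⊤)
    (hR : ∀ k, (∏ i, (X - C (a i))).coeff k ∈ R) {f : A}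
    (hf : ∀ σ : A →ₐ[ℂ] A, (∀ r ∈ R, σ r = r) → (∀ i, ∃ j, σ (a i) = a j) → σ f = f) :
    ∃ r ∈ R, ∃ s ∈ R, s ≠ 0 ∧ s * f = r := by
  let j : A →ₐ[ℂ] Q := IsScalarTower.toAlgHom ℂ A Q
  have hj : Function.Injective j := IsFractionRing.injective A Q
  -- K is the fraction field of R. As the aᵢ generate A, the field Q is the splitting field of ∏ (X
  -- - aᵢ) over K, hence Galois in characteristic 0.
  let K : IntermediateField ℂ Q := IntermediateField.adjoin ℂ (j '' R)
  have hjK (r : A) (hr : r ∈ R) : j r ∈ K := IntermediateField.subset_adjoin ℂ _ ⟨r, hr, rfl⟩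
  have hmap : (∏ i, (X - C (a i))).map (j : A →+* Q) = ∏ i, (X - C (j (a i))) := by
    simp [Polynomial.map_prod]
  obtain ⟨p, hp⟩ : ∃ p : K[X], p.map (algebraMap K Q) = ∏ i, (X - C (j (a i))) := by
    refine (mem_lifts _).1 ((lifts_iff_coeff_lifts _).2 fun k => ?_)
    rw [← hmap, coeff_map]
    exact ⟨⟨_, hjK _ (hR k)⟩, rfl⟩
  have haeval (q : Q) : aeval q p = ∏ i, (q - j (a i)) := by
    rw [aeval_def, eval₂_eq_eval_map, hp, eval_prod]
    simp
  have hp0 : p ≠ 0 := by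
    rintro rfl
    rw [Polynomial.map_zero] at hp
    exact (monic_prod_X_sub_C (fun i => j (a i)) Finset.univ).ne_zero hp.symm
  have hroot (i : ι) : j (a i) ∈ p.rootSet Q := by
    refine mem_rootSet.2 ⟨hp0, ?_⟩
    rw [haeval]
    exact Finset.prod_eq_zero (Finset.mem_univ i) (sub_self _)
  have htop : IntermediateField.adjoin K (p.rootSet Q) = ⊤ := by
    rw [eq_top_iff]
    rintro q -
    have hmem (x : A) : j x ∈ IntermediateField.adjoin K (p.rootSet Q) := by
      have hx : x ∈ Algebra.adjoin ℂ (Set.range a) := ha ▸ Algebra.mem_top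
      induction hx using Algebra.adjoin_induction with
      | mem x hx =>
        obtain ⟨i, rfl⟩ := hx
        exact IntermediateField.subset_adjoin _ _ (hroot i)
      | algebraMap r =>
        rw [AlgHom.commutes]
        exact IntermediateField.algebraMap_mem _ (algebraMap ℂ K r)
      | add x y _ _ h₁ h₂ =>
        rw [map_add]
        exact add_mem h₁ h₂
      | mul x y _ _ h₁ h₂ =>
        rw [map_mul]
        exact mul_mem h₁ h₂
    obtain ⟨x, y, -, rfl⟩ := IsFractionRing.div_surjective A q
    exact div_mem (hmem x) (hmem y)
  have hsplit : IsSplittingField K Q p := by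
    rw [isSplittingField_iff_intermediateField]
    refine ⟨?_, htop⟩
    rw [hp]
    exact Splits.prod fun i _ => Splits.X_sub_C _
  have : Normal K Q := Normal.of_isSplittingField p
  have : IsGalois K Q := ⟨⟩
  have hfix : j f ∈ (⊥ : IntermediateField K Q) := by
    refine (InfiniteGalois.mem_bot_iff_fixed (j f)).2 fun σ => ?_
    have hσa (i : ι) : ∃ k, σ (j (a i)) = j (a k) := by
      have h0 : aeval (σ (j (a i))) p = 0 := by
        rw [aeval_algHom_apply, (mem_rootSet.1 (hroot i)).2, map_zero]
      rw [haeval] at h0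
      obtain ⟨k, -, hk⟩ := Finset.prod_eq_zero_iff.1 h0
      exact ⟨k, sub_eq_zero.1 hk⟩
    -- σ permutes the roots aᵢ, which generate A, so it restricts to an endomorphism of A.
    have hrange (x : A) : σ (j x) ∈ j.range := by
      have hx : x ∈ Algebra.adjoin ℂ (Set.range a) := ha ▸ Algebra.mem_top
      induction hx using Algebra.adjoin_induction with
      | mem x hx =>
        obtain ⟨i, rfl⟩ := hx
        obtain ⟨k, hk⟩ := hσa i
        exact ⟨a k, hk.symm⟩
      | algebraMap r =>
        rw [AlgHom.commutes]
        refine ⟨algebraMap ℂ A r, ?_⟩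
        exact (j.commutes r).trans (σ.commutes (algebraMap ℂ K r)).symm
      | add x y _ _ h₁ h₂ =>
        rw [map_add, map_add]
        exact add_mem h₁ h₂
      | mul x y _ _ h₁ h₂ =>
        rw [map_mul, map_mul]
        exact mul_mem h₁ h₂
    let τ : A →ₐ[ℂ] A := (AlgEquiv.ofInjective j hj).symm.toAlgHom.comp
      ((((σ : Q →ₐ[K] Q).restrictScalars ℂ).comp j).codRestrict j.range hrange)
    have hτ (x : A) : j (τ x) = σ (j x) :=
      congrArg Subtype.val ((AlgEquiv.ofInjective j hj).apply_symm_apply ⟨σ (j x), hrange x⟩)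
    rw [← hτ, hf τ]
    · intro r hr
      refine hj ?_
      rw [hτ]
      exact σ.commutes (⟨j r, hjK r hr⟩ : K)
    · intro i
      obtain ⟨k, hk⟩ := hσa i
      exact ⟨k, hj (by rw [hτ, hk])⟩
  obtain ⟨⟨y, hy⟩, hyf⟩ := IntermediateField.mem_bot.1 hfix
  have hadj : Algebra.adjoin ℂ (j '' R) = R.map j := by
    rw [← AlgHom.map_adjoin, Algebra.adjoin_eq]
  obtain ⟨r', hr', s', hs', hrs⟩ := IntermediateField.mem_adjoin_iff_div.1 hy
  rw [hadj] at hr' hs'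
  obtain ⟨r, hr, rfl⟩ := hr'
  obtain ⟨s, hs, rfl⟩ := hs'
  have hjf : j f = j r / j s := hyf.symm.trans hrs
  -- Division by zero yields zero: in this case f = 0.
  by_cases hs0 : s = 0
  · refine ⟨0, zero_mem _, 1, one_mem _, one_ne_zero, ?_⟩
    refine hj ?_
    rw [one_mul, hjf, hs0, map_zero, div_zero]
  · refine ⟨r, hr, s, hs, hs0, hj ?_⟩
    rw [map_mul, hjf, mul_div_cancel₀]
    exact fun h => hs0 (hj (h.trans (map_zero j).symm))

/-- An element integral over `I` that is a quotient of elements of `I` comes from an integrally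
closed domain containing `I`. -/
theorem exists_eq_mul_of_isIntegralElem {A B I : Type*} [CommRing I] [CommRing A] [CommRing B]
    [IsDomain B] [IsIntegrallyClosed B] {g : I →+* A} (hg : Function.Injective g) {k : I →+* B}
    (hk : Function.Injective k) {f : A} (hf : g.IsIntegralElem f) {r s : I} (hs : s ≠ 0)
    (hrs : g s * f = g r) : ∃ b, k r = k s * b := by
  obtain ⟨q, hq, hqf⟩ := hf
  -- Clearing denominators in q(r / s) = 0 gives an identity inside I, which can be carried from A
  -- to B.
  have h1 : eval r (scaleRoots q s) = 0 := by
    refine hg ?_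
    rw [map_zero, ← eval₂_at_apply, ← hrs, scaleRoots_eval₂_eq_zero g hqf]
  let j : I →+* FractionRing B := (algebraMap B (FractionRing B)).comp k
  have hj : Function.Injective j := (IsFractionRing.injective B (FractionRing B)).comp hk
  have hjs : j s ≠ 0 := fun h => hs (hj (h.trans (map_zero j).symm))
  have h2 : eval₂ j (j r / j s) q = 0 := by
    have h3 := scaleRoots_eval₂_mul (p := q) j (j r / j s) s
    rw [mul_div_cancel₀ _ hjs, eval₂_at_apply, h1, map_zero] at h3
    exact (mul_eq_zero.1 h3.symm).resolve_left (pow_ne_zero _ hjs)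
  have h4 : IsIntegral B (j r / j s) := ⟨q.map k, hq.map k, by rw [eval₂_map]; exact h2⟩
  obtain ⟨b, hb⟩ := IsIntegrallyClosed.isIntegral_iff.1 h4
  refine ⟨b, IsFractionRing.injective B (FractionRing B) ?_⟩
  rw [map_mul, hb]
  exact (mul_div_cancel₀ _ hjs).symm

/-- Let `I` be a subalgebra of an integrally closed domain `B`, and `φ : B → A` a homomorphism to a
domain that is injective on `I`. Suppose that `A` is generated by elements `aᵢ` and `φ(I)` contains
the coefficients of `∏ (X - aᵢ)`. An element of `A` fixed by the `φ(I)`-endomorphisms of `A`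
permuting the `aᵢ` is the image of a quotient in `B` of elements of `I`. -/
theorem exists_quotient_of_forall_fixed {A B ι : Type*} [CommRing A] [IsDomain A] [Algebra ℂ A]
    [CommRing B] [IsDomain B] [IsIntegrallyClosed B] [Algebra ℂ B] [Fintype ι] {I : Subalgebra ℂ B}
    {φ : B →ₐ[ℂ] A} (hφ : ∀ F ∈ I, φ F = 0 → F = 0) {a : ι → A}
    (ha : Algebra.adjoin ℂ (Set.range a) = ⊤)
    (hI : ∀ k, (∏ i, (X - C (a i))).coeff k ∈ I.map φ) {f : A}
    (hf : ∀ σ : A →ₐ[ℂ] A, (∀ r ∈ I.map φ, σ r = r) → (∀ i, ∃ j, σ (a i) = a j) → σ f = f) :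
    ∃ F, φ F = f ∧ ∃ F₁ ∈ I, ∃ F₂ ∈ I, F₂ ≠ 0 ∧ F₁ = F₂ * F := by
  obtain ⟨_, ⟨F₁, hF₁, rfl⟩, _, ⟨F₂, hF₂, rfl⟩, hne, hmul⟩ :=
    exists_mul_mem_of_forall_fixed (FractionRing A) ha hI hf
  have hF₂0 : F₂ ≠ 0 := fun h => hne (by rw [h]; exact map_zero φ)
  let g : I →+* A := (φ.comp I.val : I →ₐ[ℂ] A)
  have hg : Function.Injective g := (injective_iff_map_eq_zero g).2 fun F hF =>
    Subtype.ext (hφ F F.2 hF)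
  -- Each aᵢ is a root of the monic polynomial ∏ (X - aᵢ) with coefficients from I, and the aᵢ
  -- generate A.
  have hint (f : A) : g.IsIntegralElem f := by
    have hf : f ∈ Algebra.adjoin ℂ (Set.range a) := ha ▸ Algebra.mem_top
    induction hf using Algebra.adjoin_induction with
    | mem f hf =>
      obtain ⟨i, rfl⟩ := hf
      obtain ⟨q, hq, -, hmonic⟩ := lifts_and_natDegree_eq_and_monic (f := g)
        ((lifts_iff_coeff_lifts _).2 fun k => by
          obtain ⟨F, hF, hFk⟩ := hI k
          exact ⟨⟨F, hF⟩, hFk⟩) (monic_prod_X_sub_C a Finset.univ)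
      refine ⟨q, hmonic, ?_⟩
      rw [eval₂_eq_eval_map, hq, eval_prod]
      exact Finset.prod_eq_zero (Finset.mem_univ i) (by simp)
    | algebraMap r =>
      have : algebraMap ℂ A r = g (algebraMap ℂ I r) := ((φ.comp I.val).commutes r).symm
      rw [this]
      exact RingHom.isIntegralElem_map _
    | add x y _ _ h₁ h₂ => exact h₁.add _ h₂
    | mul x y _ _ h₁ h₂ => exact h₁.mul _ h₂
  obtain ⟨F, hF⟩ := exists_eq_mul_of_isIntegralElem hg (k := (I.val : I →+* B))
    Subtype.val_injective (hint f) (r := ⟨F₁, hF₁⟩) (s := ⟨F₂, hF₂⟩)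
    (fun h => hF₂0 (congrArg Subtype.val h)) hmul
  have hF' : F₁ = F₂ * F := hF
  refine ⟨F, ?_, F₁, hF₁, F₂, hF₂, hF₂0, hF'⟩
  have h2 : φ F₂ * f = φ F₂ * φ F := by
    rw [← map_mul, ← hF']
    exact hmul
  exact (mul_left_cancel₀ hne h2).symm

end Galois

/-! ### Surjectivity of restriction. -/

section Surjectivity

open LieAlgebra LieAlgebra.IsKilling LieModule

theorem linearPart_injective {V : Type*} [AddCommGroup V] [Module ℂ V] :
    Function.Injective (linearPart V) := fun _ _ h =>
  LinearMap.ext fun y => congrArg (fun F : PolyFun V => (F : V → ℂ) y) h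

/-- An algebra endomorphism of `ℂ[V]` that preserves the linear functionals is the pullback along a
linear map. -/
theorem exists_eq_pullback {V : Type*} [AddCommGroup V] [Module ℂ V] [FiniteDimensional ℂ V]
    {σ : PolyFun V →ₐ[ℂ] PolyFun V}
    (hσ : ∀ l, σ (linearPart V l) ∈ LinearMap.range (linearPart V)) :
    ∃ s : V →ₗ[ℂ] V, σ = pullback s := by
  let τ : Dual ℂ V →ₗ[ℂ] Dual ℂ V :=
    (LinearEquiv.ofInjective (linearPart V) linearPart_injective).symm.toLinearMap ∘ₗ
      (σ.toLinearMap ∘ₗ linearPart V).codRestrict _ hσ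
  have hτ (l : Dual ℂ V) : linearPart V (τ l) = σ (linearPart V l) :=
    congrArg Subtype.val ((LinearEquiv.ofInjective (linearPart V)
      linearPart_injective).apply_symm_apply ⟨σ (linearPart V l), hσ l⟩)
  -- s is the transpose of τ, seen on V through biduality.
  let s : V →ₗ[ℂ] V := (evalEquiv ℂ V).symm.toLinearMap ∘ₗ τ.dualMap ∘ₗ (evalEquiv ℂ V).toLinearMap
  have hs (l : Dual ℂ V) (x : V) : l (s x) = τ l x := by
    simp [s]
  refine ⟨s, AlgHom.ext fun F => ?_⟩
  induction F using polyFun_induction with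
  | linear l => exact (hτ l).symm.trans (polyFun_ext fun x => (hs l x).symm)
  | const r => rw [AlgHom.commutes, AlgHom.commutes]
  | add F G h₁ h₂ => rw [map_add, map_add, h₁, h₂]
  | mul F G h₁ h₂ => rw [map_mul, map_mul, h₁, h₂]

variable {L : Type*} [LieRing L] [LieAlgebra ℂ L] [FiniteDimensional ℂ L]
  [LieAlgebra.IsSemisimple ℂ L] {H : LieSubalgebra ℂ L} [H.IsCartanSubalgebra]

variable (H) in
/-- The roots as polynomial functions on `H`. -/
def rootFun (α : H.root) : PolyFun H := linearPart H (α : Weight ℂ H L).toLinear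

theorem span_root_eq_top :
    Submodule.span ℂ (Set.range fun α : H.root => (α : Weight ℂ H L).toLinear) = ⊤ :=
  RootPairing.IsRootSystem.span_root_eq_top (P := rootSystem H)

theorem adjoin_rootFun : Algebra.adjoin ℂ (Set.range (rootFun H)) = ⊤ := by
  rw [eq_top_iff]
  rintro F -
  induction F using polyFun_induction with
  | linear l =>
    have hl : l ∈ Submodule.span ℂ (Set.range fun α : H.root => (α : Weight ℂ H L).toLinear) :=
      span_root_eq_top (H := H) ▸ Submodule.mem_top
    induction hl using Submodule.span_induction with
    | mem l hl =>
      obtain ⟨α, rfl⟩ := hl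
      exact Algebra.subset_adjoin ⟨α, rfl⟩
    | zero => simp
    | add x y _ _ h₁ h₂ =>
      rw [map_add]
      exact add_mem h₁ h₂
    | smul c x _ h =>
      rw [map_smul]
      exact Subalgebra.smul_mem _ h c
  | const r => exact Subalgebra.algebraMap_mem _ r
  | add F G h₁ h₂ => exact add_mem h₁ h₂
  | mul F G h₁ h₂ => exact mul_mem h₁ h₂

open Polynomial in
theorem coeff_prod_rootFun_mem (k : ℕ) :
    (∏ α, (X - C (rootFun H α))).coeff k ∈ restrictedInvariants H :=
  coeff_prod_X_sub_C_mem (fun _ hn => sum_root_pow_mem hn) k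

/-- The roots span the dual of H, so σ preserves linear functionals and comes from a linear map of
H. -/
theorem weylInvariant_fixed {σ : PolyFun H →ₐ[ℂ] PolyFun H}
    (hR : ∀ r ∈ restrictedInvariants H, σ r = r)
    (hσ : ∀ α, ∃ β, σ (rootFun H α) = rootFun H β) {f : PolyFun H} (hf : f ∈ weylInvariants H) :
    σ f = f := by
  obtain ⟨s, rfl⟩ := exists_eq_pullback (σ := σ) fun l => by
    have hl : l ∈ Submodule.span ℂ (Set.range fun α : H.root => (α : Weight ℂ H L).toLinear) :=
      span_root_eq_top (H := H) ▸ Submodule.mem_top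
    induction hl using Submodule.span_induction with
    | mem l hl =>
      obtain ⟨α, rfl⟩ := hl
      obtain ⟨β, hβ⟩ := hσ α
      exact ⟨_, hβ.symm⟩
    | zero => simp
    | add x y _ _ h₁ h₂ =>
      rw [map_add, map_add]
      exact add_mem h₁ h₂
    | smul c x _ h =>
      rw [map_smul, map_smul]
      exact Submodule.smul_mem _ c h
  refine pullback_weylInvariant (fun α => ?_) (fun F hF x => ?_) hf
  · by_cases hα : α.IsZero
    · exact ⟨α, fun x => by rw [congrFun hα, congrFun hα]; rfl⟩
    · obtain ⟨β, hβ⟩ := hσ ⟨α, by simpa using hα⟩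
      exact ⟨β, fun x => congrArg (fun g : PolyFun H => (g : H → ℂ) x) hβ⟩
  · exact congrArg (fun g : PolyFun H => (g : H → ℂ) x) (hR _ ⟨F, hF, rfl⟩)

/-- Every Weyl group invariant is the restriction of an invariant polynomial. -/
theorem exists_restrict_eq {f : PolyFun H} (hf : f ∈ weylInvariants H) :
    ∃ F ∈ adjointInvariants L, restrict H F = f := by
  obtain ⟨F, hFf, F₁, hF₁, F₂, hF₂, hF₂0, hF⟩ := exists_quotient_of_forall_fixed
    (I := adjointInvariants L) (φ := restrict H) (fun _ => restrict_injective) adjoin_rootFun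
    coeff_prod_rootFun_mem fun σ hR hσ => weylInvariant_fixed hR hσ hf
  refine ⟨F, fun x => ?_, hFf⟩
  -- Applying x to F₁ = F₂ F gives F₂ · (x · F) = 0 in a domain.
  have h1 := hF₁ x
  rw [hF, Derivation.leibniz, hF₂ x, smul_zero, add_zero, smul_eq_mul] at h1
  exact (mul_eq_zero.1 h1).resolve_left hF₂0

end Surjectivity

/-! ### Compatibility with degrees and the graded isomorphism. -/

section Scaling

variable {L : Type*} [LieRing L] [LieAlgebra ℂ L]

theorem adjointAction_scaling (x : L) (F : PolyFun L) :
    adjointAction L x (scaling F) = scaling (adjointAction L x F) := by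
  induction F using polyFun_induction with
  | linear l =>
    have h (l : Dual ℂ L) : scaling (linearPart L l) = (2 : ℂ) • linearPart L l := by
      simpa using scaling_of_mem_homogeneous (linearPart_mem_homogeneous l)
    rw [adjointAction_linear, h, h, Derivation.map_smul, adjointAction_linear]
  | const r => rw [AlgHom.commutes, Derivation.map_algebraMap, map_zero]
  | add F G h₁ h₂ => rw [map_add, map_add, map_add, map_add, h₁, h₂]
  | mul F G h₁ h₂ =>
    rw [map_mul, Derivation.leibniz, Derivation.leibniz, h₁, h₂, map_add]
    simp only [smul_eq_mul, map_mul]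

theorem scaling_mem_adjointInvariants {F : PolyFun L} (hF : F ∈ adjointInvariants L) :
    scaling F ∈ adjointInvariants L := fun x => by
  rw [adjointAction_scaling, hF x, map_zero]

variable [FiniteDimensional ℂ L]
  [LieAlgebra.IsSemisimple ℂ L] {H : LieSubalgebra ℂ L} [H.IsCartanSubalgebra]

theorem scaling_mem_weylInvariants {f : PolyFun H} (hf : f ∈ weylInvariants H) :
    scaling f ∈ weylInvariants H := fun w => by
  refine (scaling_pullback _ f).symm.trans ?_
  exact congrArg scaling (hf w)

variable (H) in
/-- The restriction isomorphism on invariants. -/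
def restrictEquiv : adjointInvariants L ≃ₐ[ℂ] weylInvariants H :=
  AlgEquiv.ofBijective (((restrict H).comp (adjointInvariants L).val).codRestrict (weylInvariants H)
    fun F => restrict_mem_weylInvariants F.2)
    ⟨fun F G h => Subtype.ext <| sub_eq_zero.1 <|
      restrict_injective (H := H) (sub_mem F.2 G.2) <| by
        rw [map_sub, sub_eq_zero]
        exact congrArg Subtype.val h, fun f => by
      obtain ⟨F, hF, hFf⟩ := exists_restrict_eq f.2
      exact ⟨⟨F, hF⟩, Subtype.ext hFf⟩⟩

theorem restrictEquiv_apply (F : adjointInvariants L) :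
    (restrictEquiv H F : PolyFun H) = restrict H F := rfl

/-- Restriction commutes with scaling, and its injectivity on invariants transfers the eigenvalue
equation for 2ⁿ back from H to L. -/
theorem map_degreePart (n : ℕ) :
    (degreePart (adjointInvariants L) n).map (restrictEquiv H).toLinearMap =
      degreePart (weylInvariants H) n := by
  have key (F : adjointInvariants L) : F ∈ degreePart (adjointInvariants L) n ↔
      restrictEquiv H F ∈ degreePart (weylInvariants H) n := by
    change (F : PolyFun L) ∈ homogeneous L n ↔ restrict H F ∈ homogeneous H n
    rw [mem_homogeneous_iff, mem_homogeneous_iff]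
    have h1 : scaling (restrict H (F : PolyFun L)) = restrict H (scaling (F : PolyFun L)) :=
      scaling_pullback _ _
    rw [h1, ← map_smul]
    refine ⟨fun h => by rw [h], fun h => ?_⟩
    rw [← sub_eq_zero]
    refine restrict_injective (H := H)
      (sub_mem (scaling_mem_adjointInvariants F.2) (Subalgebra.smul_mem _ F.2 _)) ?_
    rw [map_sub, h, sub_self]
  refine le_antisymm ?_ fun f hf => ?_
  · rintro _ ⟨F, hF, rfl⟩
    exact (key F).1 hF
  · refine ⟨(restrictEquiv H).symm f, (key _).2 ?_, (restrictEquiv H).apply_symm_apply f⟩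
    rwa [(restrictEquiv H).apply_symm_apply]

end Scaling

end

end ChevalleyRestriction

open ChevalleyRestriction in
theorem mainTheorem6 {L : Type*} [LieRing L] [LieAlgebra ℂ L] [FiniteDimensional ℂ L]
    [LieAlgebra.IsSemisimple ℂ L] (H : LieSubalgebra ℂ L) [H.IsCartanSubalgebra] :
    (∀ F ∈ adjointInvariants L, restrict H F ∈ weylInvariants H) ∧
    Nonempty (GradedAlgebra (degreePart (adjointInvariants L))) ∧
    Nonempty (GradedAlgebra (degreePart (weylInvariants H))) ∧
    ∃ e : adjointInvariants L ≃ₐ[ℂ] weylInvariants H,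
      (∀ F : adjointInvariants L, (e F : PolyFun H) = restrict H F) ∧
      ∀ n : ℕ, (degreePart (adjointInvariants L) n).map e.toLinearMap =
        degreePart (weylInvariants H) n :=
  ⟨fun _ hF => restrict_mem_weylInvariants hF,
    nonempty_gradedAlgebra fun _ hF => scaling_mem_adjointInvariants hF,
    nonempty_gradedAlgebra fun _ hf => scaling_mem_weylInvariants hf,
    restrictEquiv H, restrictEquiv_apply, map_degreePart⟩
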